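/- **Setting.** Let $G$ be a finite connected graph. An *elimination tree* of $G$ is a rooted tree on $V(G)$ obtained recursively: choose a root $v$, and make the roots of elimination trees of the connected components of $G-v$ the children of $v$ (if $V(G)=\{v\}$, the tree is the single root). For a rooted tree $T$, $T(v)$ is the subtree rooted at $v$; the ancestors of a vertex include the vertex itself. For an edge $uv$ of an elimination tree $T$, with $u$ the parent of $v$, the *rotation* of $uv$ yields the elimination tree in which $v$ is the parent of $u$, the former parent of $u$ (if any) is the parent of $v$, each child $w$ of $v$ in $T$ becomes a child of $u$ if $u$ has a neighbour in $G$ in $V(T(w))$ and stays a child of $v$ otherwise, and all other parents are unchanged. An *$\ell$-rotation sequence* from $T$ to $T'$ is a list of $\ell$ edges whose successive rotations (each in the current tree) turn $T$ into $T'$; it *uses* the endpoints of these edges. $\mathsf{dist}(T,T')$ is the minimum $\ell$ for which there is such a sequence. Let $T,T'$ be elimination trees of $G$ and let $k\ge 0$ be an integer. A vertex is *children-bad* if its sets of children in $T$ and in $T'$ differ. Let $B$ be the set of vertices at distance at most $2k$ in $T$ from the root of $T$ or from some children-bad vertex. For a connected component $Z$ of $T[B]$, let $\mathrm{root}(Z)$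 be its vertex closest to the root of $T$, and let the children of $v$ in $Z$ be the children of $v$ in $T$ that lie in $Z$. **Types.** Let $v\in Z$. The *trace* of $v$ is the binary vector of dimension $\mathsf{dist}_T(v,\mathrm{root}(Z))$ whose $i$-th coordinate is $1$ if the ancestor of $v$ at distance $i$ from $v$ has a neighbour in $G$ in $V(T(v))$, and $0$ otherwise. The *wanted parent* of $v$ is a symbol "unchanged" if $v$ has the same parent in $T$ and in $T'$ (or is the root of both); otherwise it is the parent of $v$ in $T'$, or a symbol "root", different from "unchanged", if $v$ is the root of $T'$. The *type* of $v$ in $Z$ is defined recursively from the leaves of $Z$ upwards: it consists of the wanted parent of $v$, the trace of $v$ and, if $v$ is not a leaf of $Z$, the function that maps each type $\tau$ occurring among the children of $v$ in $Z$ to $\min\{k+1,\ \text{number of children of } v \text{ in } Z \text{ of type } \tau\}$. **Marking.** For each component $Z$, a set $M_Z^{\mathsf{pre}}\subseteq Z$ of pre-marked vertices is formed as follows: for each $v\in Z$ and each type $\tau$ occurring among its children in $Z$, take all children of $v$ in $Z$ of type $\tau$ if there are at most $k+1$ of them, and $k+1$ arbitrarily chosen ones otherwise; moreover, take $\mathrm{root}(Z)$.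 Then $M_Z$ is formed as follows: start with $\mathrm{root}(Z)$; going from the root to the leaves, for each vertex $v$ already put in $M_Z$, add the children of $v$ in $Z$ that lie in $M_Z^{\mathsf{pre}}$; finally, for each children-bad vertex of $Z$, add all its ancestors that lie in $Z$. The set of *marked* vertices $M$ is the union of the sets $M_Z$ over all connected components $Z$ of $T[B]$. **Lemma.** If $\mathsf{dist}(T,T')\le k$ then, whatever the arbitrary choices in the marking, there exists an $\ell$-rotation sequence from $T$ to $T'$, for some $\ell\le k$, that uses only vertices in $M$. -/

import Mathlib

noncomputable section

namespace RotDist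

/-- `C` is the vertex set of a connected component of the induced subgraph `G[S]`. -/
def IsComponentOf {V : Type*} (G : SimpleGraph V) (S C : Set V) : Prop :=
  ∃ K : (G.induce S).ConnectedComponent, C = Subtype.val '' K.supp

/-- A rooted tree with vertex set `V`, given by its parent function: only the root has no parent,
and the root is reached from every vertex by going from child to parent. -/
structure RootedTree (V : Type*) where
  parent : V → Option V
  root : V
  parent_eq_none_iff : ∀ v, parent v = none ↔ v = root
  reaches_root : ∀ v, Relation.ReflTransGen (fun a b => parent a = some b) v root

namespace RootedTree

variable {V : Type*} (T : RootedTree V)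

/-- The set of children of `v`. -/
def children (v : V) : Set V := {u | T.parent u = some v}

/-- The set of ancestors of `v`, including `v` itself. -/
def ancestors (v : V) : Set V :=
  {a | Relation.ReflTransGen (fun x y => T.parent x = some y) v a}

/-- The set of descendants of `v`, including `v` itself; this is the vertex set of the subtree
`T(v)` rooted at `v`. -/
def desc (v : V) : Set V := {d | v ∈ T.ancestors d}

/-- The `i`-th ancestor of `v` (the vertex reached from `v` after `i` steps towards the root). -/
def nthAncestor : ℕ → V → Option V
  | 0, v => some v
  | i + 1, v => (T.parent v).bind (nthAncestor i)

/-- The underlying undirected tree. -/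
def graph : SimpleGraph V := SimpleGraph.fromRel (fun a b => T.parent a = some b)

/-- The set of vertices within distance at most `r` (in the tree) from some vertex of `S`. -/
def ball (r : ℕ) (S : Set V) : Set V := {x | ∃ y ∈ S, T.graph.dist y x ≤ r}

end RootedTree

/-- An elimination tree of the connected graph `G`: a rooted tree on the vertex set of `G` such
that, at every vertex `v`, removing `v` from the vertex set of `T(v)` leaves a graph whose connected
components are exactly the vertex sets of the subtrees rooted at the children of `v`. For the root
this is the first step of the usual recursive definition (choose the root `v`, then put below `v`
one elimination tree for each connected component of `G - v`), for the other vertices it is the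
step of the recursion at which they are chosen. -/
structure ElimTree {V : Type*} (G : SimpleGraph V) extends RootedTree V where
  component_iff : ∀ (v : V) (C : Set V),
    IsComponentOf G (toRootedTree.desc v \ {v}) C ↔
      ∃ c ∈ toRootedTree.children v, C = toRootedTree.desc c

section Rotation

variable {V : Type*} {G : SimpleGraph V}

open Classical in
/-- The parent function of the tree obtained from `T` by rotating the edge `uv`, where `u` is the
parent of `v`: `v` becomes the parent of `u`, the former parent of `u` (if any) becomes the parent
of `v`, and a child `w` of `v` becomes a child of `u` if `u` has a neighbour in `T(w)`, and remains
a child of `v` otherwise. All other parents are unchanged. -/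
def rotParent (T : ElimTree G) (u v x : V) : Option V :=
  if x = u then some v
  else if x = v then T.parent u
  else if T.parent x = some v then
    (if ∃ y ∈ T.desc x, G.Adj u y then some u else some v)
  else T.parent x

/-- `T₁` is the elimination tree obtained from `T` by the rotation of the edge `uv` of `T`, where
`u` is the parent of `v` in `T`. -/
def IsRotation (T : ElimTree G) (u v : V) (T₁ : ElimTree G) : Prop :=
  T.parent v = some u ∧ ∀ x, T₁.parent x = rotParent T u v x

/-- `IsRotationSeq T σ T'`: the list `σ` of edges, each written as (parent, child), is a
`σ.length`-rotation sequence from `T` to `T'`. -/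
inductive IsRotationSeq : ElimTree G → List (V × V) → ElimTree G → Prop
  | nil (T : ElimTree G) : IsRotationSeq T [] T
  | cons {T T₁ T' : ElimTree G} {u v : V} {σ : List (V × V)} :
      IsRotation T u v T₁ → IsRotationSeq T₁ σ T' → IsRotationSeq T ((u, v) :: σ) T'

/-- The rotation distance: the minimum length of a rotation sequence from `T` to `T'`. -/
def rotDist (T T' : ElimTree G) : ℕ∞ :=
  ⨅ (σ : List (V × V)) (_ : IsRotationSeq T σ T'), (σ.length : ℕ∞)

/-- All vertices used by the sequence `σ` (the endpoints of its edges) belong to `M`. -/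
def UsesOnly (σ : List (V × V)) (M : Set V) : Prop := ∀ e ∈ σ, e.1 ∈ M ∧ e.2 ∈ M

end Rotation

section Marking

variable {V : Type*} {G : SimpleGraph V}

/-- `v` is `(T,T')`-children-bad. -/
def ChildrenBad (T T' : ElimTree G) (v : V) : Prop := T.children v ≠ T'.children v

/-- The union of the balls of radius `2k` in `T` around the root of `T` and the
children-bad vertices. -/
def ballsCB (T T' : ElimTree G) (k : ℕ) : Set V :=
  T.ball (2 * k) ({v | ChildrenBad T T' v} ∪ {T.root})

/-- `Z` is (the vertex set of) a connected component of `T[B]`, with `B` the above union of balls. -/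
def IsCBComponent (T T' : ElimTree G) (k : ℕ) (Z : Set V) : Prop :=
  IsComponentOf T.graph (ballsCB T T' k) Z

/-- The root of `Z`: the vertex of `Z` closest to the root of `T`. -/
def rootOf (T : ElimTree G) (Z : Set V) : V :=
  @Classical.epsilon V ⟨T.root⟩
    (fun r => r ∈ Z ∧ ∀ x ∈ Z, T.graph.dist r T.root ≤ T.graph.dist x T.root)

open Classical in
/-- The trace of `v` in `Z`: the binary vector of dimension `dist_T(v, root(Z))` whose `i`-th
coordinate (`i = 1, 2, …`) tells whether the `i`-th ancestor of `v` has a neighbour in `T(v)`. -/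
def trace (T : ElimTree G) (Z : Set V) (v : V) : List Bool :=
  List.ofFn (fun i : Fin (T.graph.dist v (rootOf T Z)) =>
    decide (∃ u, T.nthAncestor (i + 1) v = some u ∧ ∃ w ∈ T.desc v, G.Adj w u))

open Classical in
/-- The parent that `v` wants: `none` if the parent of `v` is the same in `T` and in `T'`, and
`some p` otherwise, where `p` is the parent of `v` in `T'` (`p` itself is `none` if `v` is the
root of `T'`). -/
def wantParent (T T' : ElimTree G) (v : V) : Option (Option V) :=
  if T.parent v = T'.parent v then none else some (T'.parent v)

/-- The values of types computed with `n` levels of recursion: a wanted parent, a trace, and for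
each type `t` of the previous level the number of children of type `t`, truncated at `k + 1`. -/
def TypeVal.{u} (V : Type u) : ℕ → Type u
  | 0 => PUnit
  | n + 1 => Option (Option V) × List Bool × (TypeVal V n → ℕ)

/-- The type of `v` in `Z` computed with `n` levels of recursion. The third component counts, up to
`k + 1`, the children of `v` in `Z` of each type; it is `0` at the types which do not occur among
the children of `v`, so it is the zero function exactly if `v` is a leaf of `Z`. -/
def typeAux (T T' : ElimTree G) (k : ℕ) (Z : Set V) : (n : ℕ) → V → TypeVal V n
  | 0, _ => PUnit.unit
  | n + 1, v => (wantParent T T' v, trace T Z v, fun t =>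
      min (k + 1) {u | u ∈ T.children v ∩ Z ∧ typeAux T T' k Z n u = t}.ncard)

/-- The type of `v` in `Z`. The recursion stops at the leaves of `Z`, and a tree on `|V|` vertices
has at most `|V|` levels, so `|V|` levels of recursion compute the whole type. -/
def vtype (T T' : ElimTree G) (k : ℕ) (Z : Set V) (v : V) : TypeVal V (Nat.card V) :=
  typeAux T T' k Z (Nat.card V) v

/-- The children of `v` in `Z` of type `t`. -/
def childrenOfType (T T' : ElimTree G) (k : ℕ) (Z : Set V) (v : V)
    (t : TypeVal V (Nat.card V)) : Set V :=
  {u | u ∈ T.children v ∩ Z ∧ vtype T T' k Z u = t}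

/-- `P` is a possible set of pre-marked vertices of `Z`, that is, one that results from some
choices in the marking algorithm: it contains the root of `Z` and, for each `v ∈ Z` and each
type `t`, all the children of `v` in `Z` of type `t` if there are at most `k + 1` of them, and
exactly `k + 1` of them otherwise. (Each vertex of `Z` other than its root is a child in `Z` of
exactly one vertex of `Z`, so this determines `P` up to the choices.) -/
structure IsPreMarking (T T' : ElimTree G) (k : ℕ) (Z P : Set V) : Prop where
  subset : P ⊆ Z
  root_mem : rootOf T Z ∈ P
  all_of_le : ∀ v ∈ Z, ∀ t, (childrenOfType T T' k Z v t).ncard ≤ k + 1 →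
    childrenOfType T T' k Z v t ⊆ P
  card_of_lt : ∀ v ∈ Z, ∀ t, k + 1 < (childrenOfType T T' k Z v t).ncard →
    (childrenOfType T T' k Z v t ∩ P).ncard = k + 1

/-- The root-to-leaf pruning of the pre-marked set `P` of `Z`: the root of `Z` is kept, and so is
each pre-marked child in `Z` of a kept vertex. -/
inductive Kept (T : ElimTree G) (Z P : Set V) : V → Prop
  | root : Kept T Z P (rootOf T Z)
  | child {v u : V} : Kept T Z P v → u ∈ T.children v ∩ Z → u ∈ P → Kept T Z P u

/-- The set of marked vertices of `Z`, given its pre-marked set `P`: the kept vertices, and the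
ancestors in `Z` of the children-bad vertices that belong to `Z`. -/
def markedIn (T T' : ElimTree G) (Z P : Set V) : Set V :=
  {v | Kept T Z P v} ∪ {a | a ∈ Z ∧ ∃ b ∈ Z, ChildrenBad T T' b ∧ a ∈ T.ancestors b}

/-- The set of marked vertices of `T`, where `P Z` is the pre-marked set chosen in the
component `Z`. -/
def marked (T T' : ElimTree G) (k : ℕ) (P : Set V → Set V) : Set V :=
  {v | ∃ Z, IsCBComponent T T' k Z ∧ v ∈ markedIn T T' Z (P Z)}

end Marking

end RotDist

end

namespace RotDist

/-! Take a shortest rotation sequence from `T` to `T'` and let `S` be its set of used vertices, so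
that `S` has at most `2k` elements. Every vertex of `S` turns out to be kept by the pruning; the
extra marking of ancestors of children-bad vertices is not needed.

The engine is a deletion argument (`exists_shorter`). Let `L` be the part of `T(q)` reached from `q`
inside `S`. In every intermediate tree, put `L` back as it was in `T`. A rotation that avoids `L`
remains a rotation of the restored trees, and one that meets `L` becomes trivial. If `T'` agrees
with `T` on `L`, both ends are their own restorations, so the rotations that meet `L` can be
dropped. The restored trees exist as soon as, in each intermediate tree, all outside neighbours of
`T(q)` lie above one common vertex `c`. Elimination trees are handled through their families of
subtrees (`exists_of_desc`, `ext_desc`), where a rotation exchanges two comparable vertices and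
keeps all other subtrees (`isRotation_iff`).

Deletion is used twice. First, a component of `T[S]` with neither the root of `T` nor a children-bad
vertex could be deleted; hence each component has such a vertex, and by its size it lies in the
union `B` of balls (`exists_childrenBad_of_shortest`, `pathsIn_subset_ballsCB`).

Second, suppose a used vertex of a component `Z` of `T[B]` is not kept. The path to it from the root
of `Z` leaves the kept set at some `q`, which is not pre-marked. So `q` has `k+1` pre-marked
siblings of its type, and `k` rotations leave the subtree of one of them, `s`, untouched. Equality
of types transfers this calm from `s` to `q`: no vertex of `T(q)` in `Z` is children-bad
(`not_childrenBad_of_vtype_eq`). Equality of traces makes `s` a valid `c`. Deletion at `q` then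
contradicts minimality (`kept_of_shortest`). -/

/-- `X` induces a connected (possibly empty) subgraph of `G`, stated as an induction principle. -/
def ConnectedOn {V : Type*} (G : SimpleGraph V) (X : Set V) : Prop :=
  ∀ Y : Set V, (X ∩ Y).Nonempty → (∀ a ∈ X, a ∈ Y → ∀ b ∈ X, G.Adj a b → b ∈ Y) → X ⊆ Y

/-! ### Connected vertex sets and components -/

section Connected

variable {V : Type*} {G : SimpleGraph V}

theorem ConnectedOn.preconnected {X : Set V} (h : ConnectedOn G X) :
    (G.induce X).Preconnected := by
  intro a b
  have := h (Subtype.val '' {c : X | (G.induce X).Reachable a c})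
    ⟨a, a.2, a, SimpleGraph.Reachable.refl a, rfl⟩ (by
      rintro _ - ⟨c, hc, rfl⟩ d hd hcd
      exact ⟨⟨d, hd⟩, SimpleGraph.Reachable.trans hc
        (SimpleGraph.Adj.reachable (by simpa using hcd)), rfl⟩)
  obtain ⟨c, hc, hcb⟩ := this b.2
  rwa [← Subtype.ext hcb]

theorem connectedOn_univ (h : G.Connected) : ConnectedOn G Set.univ := by
  rintro Y ⟨a, -, ha⟩ hY b -
  have := (SimpleGraph.reachable_iff_reflTransGen a b).1 (h.preconnected a b)
  induction this with
  | refl => exact ha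
  | tail _ hbc ih => exact hY _ trivial ih _ trivial hbc

/-- This form avoids subtypes, so components can be compared by pushing membership along edges. -/
theorem isComponentOf_iff {S C : Set V} :
    IsComponentOf G S C ↔ C.Nonempty ∧ C ⊆ S ∧ ConnectedOn G C ∧
      ∀ a ∈ C, ∀ b ∈ S, G.Adj a b → b ∈ C := by
  constructor
  · rintro ⟨K, rfl⟩
    have hclosed : ∀ a ∈ Subtype.val '' K.supp, ∀ b ∈ S, G.Adj a b →
        b ∈ Subtype.val '' K.supp := by
      rintro _ ⟨a, ha, rfl⟩ b hb hab
      refine ⟨⟨b, hb⟩, ?_, rfl⟩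
      have : (G.induce S).Adj a ⟨b, hb⟩ := by simpa using hab
      exact (K.mem_supp_congr_adj this).1 ha
    refine ⟨?_, ?_, ?_, hclosed⟩
    · obtain ⟨a, ha⟩ := K.nonempty_supp
      exact ⟨a, a, ha, rfl⟩
    · rintro _ ⟨a, -, rfl⟩
      exact a.2
    · rintro Y ⟨_, ⟨a, ha, rfl⟩, haY⟩ hY _ ⟨b, hb, rfl⟩
      have hab : (G.induce S).Reachable a b :=
        SimpleGraph.ConnectedComponent.exact (ha.trans hb.symm)
      have : ∀ c, Relation.ReflTransGen (G.induce S).Adj a c →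
          (c : V) ∈ Subtype.val '' K.supp ∧ (c : V) ∈ Y := by
        intro c hc
        induction hc with
        | refl => exact ⟨⟨a, ha, rfl⟩, haY⟩
        | @tail c d _ hcd ih =>
          have hcd' : G.Adj c d := by simpa using hcd
          have := hclosed _ ih.1 _ d.2 hcd'
          exact ⟨this, hY _ ih.1 ih.2 _ this hcd'⟩
      exact (this b ((SimpleGraph.reachable_iff_reflTransGen a b).1 hab)).2
  · rintro ⟨⟨a, ha⟩, hCS, hC, hclosed⟩
    refine ⟨(G.induce S).connectedComponentMk ⟨a, hCS ha⟩, Set.Subset.antisymm ?_ ?_⟩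
    · refine hC _ ⟨a, ha, ⟨a, hCS ha⟩, rfl, rfl⟩ ?_
      rintro _ - ⟨c, hc, rfl⟩ d hd hcd
      have : (G.induce S).Adj c ⟨d, hCS hd⟩ := by simpa using hcd
      exact ⟨⟨d, hCS hd⟩, (SimpleGraph.ConnectedComponent.mem_supp_congr_adj _ this).1 hc, rfl⟩
    · rintro _ ⟨b, hb, rfl⟩
      have hab : (G.induce S).Reachable ⟨a, hCS ha⟩ b :=
        (SimpleGraph.ConnectedComponent.exact hb).symm
      have := (SimpleGraph.reachable_iff_reflTransGen _ b).1 hab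
      induction this with
      | refl => exact ha
      | @tail c d hc hcd ih =>
        have hc' := (SimpleGraph.reachable_iff_reflTransGen _ c).2 hc
        exact hclosed _ (ih (SimpleGraph.ConnectedComponent.sound hc'.symm) hc') _ d.2
          (by simpa using hcd)

theorem exists_isComponentOf {S : Set V} {a : V} (ha : a ∈ S) :
    ∃ C, IsComponentOf G S C ∧ a ∈ C :=
  ⟨_, ⟨(G.induce S).connectedComponentMk ⟨a, ha⟩, rfl⟩, ⟨a, ha⟩, rfl, rfl⟩

theorem ConnectedOn.dist_lt_ncard [Finite V] {X : Set V} (h : ConnectedOn G X) {a b : V}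
    (ha : a ∈ X) (hb : b ∈ X) : G.dist a b < X.ncard := by
  classical
  have : Fintype X := Fintype.ofFinite X
  obtain ⟨p, hp⟩ := (h.preconnected ⟨a, ha⟩ ⟨b, hb⟩).exists_isPath
  have h1 := hp.length_lt
  have h2 := SimpleGraph.dist_le (p.map (SimpleGraph.Embedding.induce X).toHom)
  rw [SimpleGraph.Walk.length_map] at h2
  rw [← Nat.card_coe_set_eq, Nat.card_eq_fintype_card]
  exact lt_of_le_of_lt h2 h1

end Connected

/-! ### The descendant order of a rooted tree -/

namespace RootedTree

variable {V : Type*} (T : RootedTree V)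

theorem mem_desc_iff {x y : V} :
    y ∈ T.desc x ↔ Relation.ReflTransGen (fun a b => T.parent a = some b) y x := Iff.rfl

theorem mem_desc_self (x : V) : x ∈ T.desc x := Relation.ReflTransGen.refl

theorem desc_root : T.desc T.root = Set.univ :=
  Set.eq_univ_of_forall T.reaches_root

theorem parent_root : T.parent T.root = none := (T.parent_eq_none_iff _).2 rfl

variable {T}

theorem mem_desc_of_parent {x y : V} (h : T.parent x = some y) : x ∈ T.desc y :=
  Relation.ReflTransGen.single h

theorem mem_desc_trans {x y z : V} (h : x ∈ T.desc y) (h' : y ∈ T.desc z) : x ∈ T.desc z :=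
  Relation.ReflTransGen.trans h h'

theorem desc_subset {x y : V} (h : x ∈ T.desc y) : T.desc x ⊆ T.desc y :=
  fun _ hz => mem_desc_trans hz h

theorem mem_desc_cases {x y : V} (h : x ∈ T.desc y) :
    x = y ∨ ∃ p, T.parent x = some p ∧ p ∈ T.desc y := by
  rcases Relation.ReflTransGen.cases_head h with h | ⟨p, hp, h⟩
  · exact Or.inl h
  · exact Or.inr ⟨p, hp, h⟩

theorem parent_mem_desc {x y p : V} (h : x ∈ T.desc y) (hne : x ≠ y) (hp : T.parent x = some p) :
    p ∈ T.desc y := by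
  rcases mem_desc_cases h with h | ⟨p', hp', h⟩
  · exact absurd h hne
  · rw [hp] at hp'
    cases hp'
    exact h

theorem exists_child {x y : V} (h : x ∈ T.desc y) (hne : x ≠ y) :
    ∃ c, T.parent c = some y ∧ x ∈ T.desc c := by
  rcases Relation.ReflTransGen.cases_tail h with h | ⟨c, h, hc⟩
  · exact absurd h.symm hne
  · exact ⟨c, hc, h⟩

theorem mem_desc_chain {x y z : V} (h : z ∈ T.desc x) (h' : z ∈ T.desc y) :
    x ∈ T.desc y ∨ y ∈ T.desc x := by
  induction h using Relation.ReflTransGen.head_induction_on with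
  | refl => exact Or.inl h'
  | @head a c hac hc ih =>
    by_cases hay : a = y
    · subst hay
      exact Or.inr (Relation.ReflTransGen.head hac hc)
    · exact ih (parent_mem_desc h' hay hac)

theorem eq_root_of_mem_desc {y : V} (h : T.root ∈ T.desc y) : y = T.root := by
  rcases mem_desc_cases h with h | ⟨p, hp, -⟩
  · exact h.symm
  · rw [T.parent_root] at hp
    cases hp

theorem mem_desc_antisymm {x y : V} (h : x ∈ T.desc y) (h' : y ∈ T.desc x) : x = y := by
  by_contra hne
  have key : ∀ z, x ∈ T.desc z → z ∈ T.desc x := by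
    intro z hz
    rw [mem_desc_iff] at hz
    induction hz with
    | refl => exact T.mem_desc_self x
    | @tail a b _ hab ih =>
      by_cases hax : a = x
      · subst hax
        exact mem_desc_trans (parent_mem_desc h hne hab) h'
      · exact parent_mem_desc ih hax hab
  have hx : x = T.root := eq_root_of_mem_desc (key _ (T.reaches_root x))
  subst hx
  exact hne (eq_root_of_mem_desc h).symm

theorem parent_ne {x y : V} (h : T.parent x = some y) : x ≠ y := by
  rintro rfl
  have key : ∀ z, x ∈ T.desc z → z = x := by
    intro z hz
    rw [mem_desc_iff] at hz
    induction hz with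
    | refl => rfl
    | @tail a b _ hab ih =>
      subst ih
      rw [h] at hab
      cases hab
      rfl
  have := key _ (T.reaches_root x)
  rw [← this, T.parent_root] at h
  cases h

theorem parent_notMem_desc {x y : V} (h : T.parent x = some y) : y ∉ T.desc x :=
  fun h' => parent_ne h (mem_desc_antisymm (mem_desc_of_parent h) h')

/-- The parent is the least proper ancestor, so the family of subtrees determines the tree; later
arguments use only this family. -/
theorem parent_eq_some_iff {x y : V} :
    T.parent x = some y ↔ x ≠ y ∧ x ∈ T.desc y ∧ ∀ z, z ≠ x → x ∈ T.desc z → y ∈ T.desc z := by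
  constructor
  · exact fun h => ⟨parent_ne h, mem_desc_of_parent h, fun z hz hx => parent_mem_desc hx hz.symm h⟩
  · rintro ⟨hne, h, hmin⟩
    rcases mem_desc_cases h with h | ⟨p, hp, h⟩
    · exact absurd h hne
    · rw [hp, mem_desc_antisymm h (hmin p (parent_ne hp).symm (mem_desc_of_parent hp))]

theorem parent_eq_none_iff_desc {x : V} :
    T.parent x = none ↔ T.desc x = Set.univ := by
  rw [T.parent_eq_none_iff]
  constructor
  · rintro rfl
    exact T.desc_root
  · intro h
    exact eq_root_of_mem_desc (h ▸ Set.mem_univ _)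

theorem ncard_desc_lt [Finite V] {x y : V} (h : T.parent x = some y) :
    (T.desc x).ncard < (T.desc y).ncard :=
  Set.ncard_lt_ncard ⟨desc_subset (mem_desc_of_parent h),
    fun h' => parent_notMem_desc h (h' (T.mem_desc_self y))⟩

theorem ncard_desc_pos [Finite V] (x : V) : 0 < (T.desc x).ncard :=
  (Set.ncard_pos).2 ⟨x, T.mem_desc_self x⟩

theorem disjoint_desc_of_siblings {x y p : V} (hx : T.parent x = some p) (hy : T.parent y = some p)
    (hne : x ≠ y) : Disjoint (T.desc x) (T.desc y) := by
  rw [Set.disjoint_left]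
  intro z hzx hzy
  rcases mem_desc_chain hzx hzy with h | h
  · exact parent_notMem_desc hy (parent_mem_desc h hne hx)
  · exact parent_notMem_desc hx (parent_mem_desc h hne.symm hy)

theorem ext_desc {T' : RootedTree V} (h : ∀ x, T.desc x = T'.desc x) : T = T' := by
  have hp : T.parent = T'.parent := by
    funext x
    cases hx : T.parent x with
    | none =>
      rw [parent_eq_none_iff_desc, h] at hx
      exact (parent_eq_none_iff_desc.2 hx).symm
    | some p =>
      rw [parent_eq_some_iff] at hx
      simp only [h] at hx
      exact (parent_eq_some_iff.2 hx).symm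
  have hr : T.root = T'.root := by
    rw [← T'.parent_eq_none_iff, ← hp, T.parent_eq_none_iff]
  cases T
  cases T'
  cases hp
  cases hr
  rfl

end RootedTree

open RotDist.RootedTree

/-! ### Elimination trees as families of connected sets -/

namespace ElimTree

variable {V : Type*} {G : SimpleGraph V} {T T' : ElimTree G}

theorem ext_desc (h : ∀ x, T.desc x = T'.desc x) : T = T' := by
  have := RootedTree.ext_desc h
  cases T
  cases T'
  cases this
  rfl

theorem isComponentOf_desc {c v : V} (h : T.parent c = some v) :
    IsComponentOf G (T.desc v \ {v}) (T.desc c) :=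
  (T.component_iff v _).2 ⟨c, h, rfl⟩

theorem desc_closed {c v a b : V} (h : T.parent c = some v) (ha : a ∈ T.desc c)
    (hb : b ∈ T.desc v) (hne : b ≠ v) (hab : G.Adj a b) : b ∈ T.desc c :=
  (isComponentOf_iff.1 (isComponentOf_desc h)).2.2.2 a ha b ⟨hb, hne⟩ hab

theorem connectedOn_desc (hG : G.Connected) (T : ElimTree G) (x : V) :
    ConnectedOn G (T.desc x) := by
  cases h : T.parent x with
  | none =>
    rw [parent_eq_none_iff_desc.1 h]
    exact connectedOn_univ hG
  | some p => exact (isComponentOf_iff.1 (isComponentOf_desc h)).2.2.1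

/-- Descend from the root: while both ends differ from the current vertex, the edge stays within the
subtree of a single child. -/
theorem mem_desc_or_of_adj [Finite V] {a b : V} (hab : G.Adj a b) :
    a ∈ T.desc b ∨ b ∈ T.desc a := by
  have key : ∀ n v, (T.desc v).ncard ≤ n → a ∈ T.desc v → b ∈ T.desc v →
      a ∈ T.desc b ∨ b ∈ T.desc a := by
    intro n
    induction n with
    | zero =>
      intro v hv
      exact absurd (T.ncard_desc_pos v) (by omega)
    | succ n ih =>
      intro v hv ha hb
      by_cases hav : a = v
      · exact Or.inr (hav ▸ hb)
      by_cases hbv : b = v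
      · exact Or.inl (hbv ▸ ha)
      obtain ⟨c, hc, hac⟩ := exists_child ha hav
      exact ih c (by have := ncard_desc_lt hc; omega) hac (desc_closed hc hac hb hbv hab)
  exact key _ T.root le_rfl (T.reaches_root a) (T.reaches_root b)

/-- A vertex outside `T(x)` with a neighbour in `T(x)` is an ancestor of `x`. -/
theorem mem_desc_of_adj [Finite V] {x a b : V} (hb : b ∈ T.desc x) (ha : a ∉ T.desc x)
    (hab : G.Adj a b) : x ∈ T.desc a := by
  rcases mem_desc_or_of_adj (T := T) hab with h | h
  · exact absurd (mem_desc_trans h hb) ha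
  · rcases mem_desc_chain h hb with h' | h'
    · exact absurd h' ha
    · exact h'

/-- Otherwise `T(c)` would be closed under adjacency in the connected set `T(v)`, hence would
contain `v`. -/
theorem exists_adj_desc (hG : G.Connected) {c v : V} (h : T.parent c = some v) :
    ∃ y ∈ T.desc c, G.Adj v y := by
  by_contra! hcon
  refine parent_notMem_desc h (connectedOn_desc hG T v (T.desc c)
    ⟨c, mem_desc_of_parent h, T.mem_desc_self c⟩ ?_ (T.mem_desc_self v))
  intro a _ hac b hb hab
  by_cases hbv : b = v
  · subst hbv
    exact absurd hab.symm (hcon a hac)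
  · exact desc_closed h hac hb hbv hab

/-- Vertices with the same subtree in two elimination trees have children with the same subtrees. -/
theorem exists_child_desc_eq {c v : V} (hv : T.desc v = T'.desc v) (h : T.parent c = some v) :
    ∃ c', T'.parent c' = some v ∧ T'.desc c' = T.desc c := by
  have := isComponentOf_desc h
  rw [hv] at this
  obtain ⟨c', hc', he⟩ := (T'.component_iff v _).1 this
  exact ⟨c', hc', he.symm⟩

/-- Elimination trees that agree on all subtrees but one are equal. -/
theorem eq_of_desc_eq_of_ne [Finite V] (hG : G.Connected) {u : V}
    (h : ∀ x, x ≠ u → T.desc x = T'.desc x) : T = T' := by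
  have key : ∀ {T T' : ElimTree G}, (∀ x, x ≠ u → T.desc x = T'.desc x) →
      T.desc u ⊆ T'.desc u := by
    intro T T' h
    refine connectedOn_desc hG T u _ ⟨u, T.mem_desc_self u, T'.mem_desc_self u⟩ ?_
    intro a _ ha' b hb hab
    by_cases hbu : b = u
    · exact hbu ▸ T'.mem_desc_self u
    have hub : u ∉ T'.desc b := by
      rw [← h b hbu]
      exact fun h' => hbu (mem_desc_antisymm hb h')
    -- `a` lies in `T'(u)` and is adjacent to `b`, so `b` outside `T'(u)` would be an ancestor of
    -- `u` in `T'`; but `b` is strictly below `u` in `T` and its subtree is the same in both trees.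
    by_contra hb'
    exact hub (mem_desc_of_adj ha' hb' hab.symm)
  refine ext_desc fun x => ?_
  by_cases hx : x = u
  · subst hx
    exact Set.Subset.antisymm (key h) (key fun y hy => (h y hy).symm)
  · exact h x hx

/-- A family of connected sets with the order properties of the subtrees of an elimination tree is
the family of subtrees of one. -/
theorem exists_of_desc [Finite V] (hG : G.Connected) (D : V → Set V)
    (hself : ∀ x, x ∈ D x) (htrans : ∀ x y, y ∈ D x → D y ⊆ D x)
    (hanti : ∀ x y, x ∈ D y → y ∈ D x → x = y)
    (hconn : ∀ x, ConnectedOn G (D x))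
    (hadj : ∀ x y, G.Adj x y → x ∈ D y ∨ y ∈ D x)
    (hchain : ∀ x y z, z ∈ D x → z ∈ D y → x ∈ D y ∨ y ∈ D x) :
    ∃ T : ElimTree G, ∀ x, T.desc x = D x := by
  classical
  have hlt : ∀ x y, x ≠ y → x ∈ D y → (D x).ncard < (D y).ncard := fun x y hne h =>
    Set.ncard_lt_ncard ⟨htrans _ _ h, fun h' => hne (hanti _ _ h (h' (hself y)))⟩
  obtain ⟨v₀⟩ := hG.nonempty
  have : Nonempty V := ⟨v₀⟩
  -- The root is a vertex with the largest set; that set is closed under adjacency, hence is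
  -- everything.
  obtain ⟨r, hr⟩ := Finite.exists_max (fun x => (D x).ncard)
  have hroot : ∀ x, x ∈ D r := by
    intro x
    refine connectedOn_univ hG (D r) ⟨r, trivial, hself r⟩ ?_ (Set.mem_univ x)
    intro a _ ha b _ hab
    have hmax : ∀ b, r ∈ D b → b ∈ D r := by
      intro b hb
      by_contra hbr
      exact absurd (hlt r b (fun h => hbr (h ▸ hself r)) hb) (not_lt.2 (hr b))
    rcases hadj a b hab with h | h
    · rcases hchain _ _ _ ha h with h' | h'
      · exact hmax b h'
      · exact h'
    · exact htrans _ _ ha h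
  -- The parent of `x` is the owner of the smallest other set containing `x`; the chain condition
  -- makes it least.
  have hpar : ∀ x, x ≠ r → ∃ y, x ≠ y ∧ x ∈ D y ∧ ∀ z, z ≠ x → x ∈ D z → y ∈ D z := by
    intro x hx
    obtain ⟨y, ⟨hyx, hxy⟩, hmin⟩ := Set.exists_min_image {y | x ≠ y ∧ x ∈ D y}
      (fun y => (D y).ncard) (Set.toFinite _) ⟨r, hx, hroot x⟩
    refine ⟨y, hyx, hxy, fun z hzx hxz => ?_⟩
    by_contra hyz
    rcases hchain _ _ _ hxy hxz with h | h
    · exact hyz h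
    · exact absurd (hlt z y (fun h' => hyz (h' ▸ hself z)) h)
        (not_lt.2 (hmin z ⟨hzx.symm, hxz⟩))
  choose! p hp using hpar
  have hclimb : ∀ x z, x ∈ D z →
      Relation.ReflTransGen (fun a b => (if a = r then none else some (p a)) = some b) x z := by
    have : ∀ n x z, (D z).ncard ≤ (D x).ncard + n → x ∈ D z →
      Relation.ReflTransGen (fun a b => (if a = r then none else some (p a)) = some b) x z := by
      intro n
      induction n with
      | zero =>
        intro x z hn hxz
        by_cases hne : x = z
        · exact hne ▸ Relation.ReflTransGen.refl
        · exact absurd (hlt x z hne hxz) (by omega)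
      | succ n ih =>
        intro x z hn hxz
        by_cases hne : x = z
        · exact hne ▸ Relation.ReflTransGen.refl
        have hxr : x ≠ r := fun h => hne (hanti _ _ hxz (h ▸ hroot z))
        have h1 := hp x hxr
        have h2 := hlt x (p x) h1.1 h1.2.1
        exact Relation.ReflTransGen.head (by simp [hxr])
          (ih (p x) z (by omega) (h1.2.2 z (Ne.symm hne) hxz))
    exact fun x z => this (D z).ncard x z (by omega)
  let R : RootedTree V :=
    { parent := fun a => if a = r then none else some (p a)
      root := r
      parent_eq_none_iff := fun v => by by_cases h : v = r <;> simp [h]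
      reaches_root := fun v => hclimb v r (hroot v) }
  have hR : ∀ x, R.desc x = D x := by
    intro x
    ext y
    refine ⟨fun h => ?_, fun h => hclimb y x h⟩
    rw [mem_desc_iff] at h
    induction h using Relation.ReflTransGen.head_induction_on with
    | refl => exact hself x
    | @head a c hac _ ih =>
      by_cases har : a = r
      · simp [R, har] at hac
      · simp only [R, har, if_false, Option.some.injEq] at hac
        exact htrans _ _ (hac ▸ ih) (hp a har).2.1
  have hcl : ∀ c v, R.parent c = some v → ∀ a ∈ D c, ∀ b ∈ D v, b ≠ v → G.Adj a b → b ∈ D c := by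
    intro c v hc a ha b hb hbv hab
    rw [parent_eq_some_iff] at hc
    simp only [hR] at hc
    have hb_c : b ∈ D c ∨ c ∈ D b := by
      rcases hadj a b hab with h | h
      · exact (hchain _ _ _ ha h).symm
      · exact Or.inl (htrans _ _ ha h)
    rcases hb_c with h | h
    · exact h
    · by_cases hbc : b = c
      · exact hbc ▸ hself b
      · exact absurd (hanti _ _ hb (hc.2.2 b hbc h)) hbv
  have hcomp : ∀ c v, R.parent c = some v → IsComponentOf G (D v \ {v}) (D c) := by
    intro c v hc
    refine isComponentOf_iff.2 ⟨⟨c, hself c⟩, ?_, hconn c,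
      fun a ha b hb hab => hcl c v hc a ha b hb.1 hb.2 hab⟩
    intro a ha
    rw [← hR] at ha ⊢
    refine ⟨mem_desc_trans ha (mem_desc_of_parent hc), ?_⟩
    rintro rfl
    exact parent_notMem_desc hc ha
  refine ⟨⟨R, fun v C => ?_⟩, hR⟩
  constructor
  · intro hC
    rw [hR, isComponentOf_iff] at hC
    obtain ⟨⟨a, ha⟩, hCS, hCc, hCcl⟩ := hC
    obtain ⟨hav, hne⟩ := hCS ha
    rw [← hR] at hav
    obtain ⟨c, hc, hac⟩ := exists_child hav hne
    refine ⟨c, hc, ?_⟩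
    rw [hR] at hac ⊢
    have h2 := (isComponentOf_iff.1 (hcomp c v hc))
    exact Set.Subset.antisymm
      (hCc _ ⟨a, ha, hac⟩ fun x _ hx y hy hxy => h2.2.2.2 x hx y (hCS hy) hxy)
      (h2.2.2.1 _ ⟨a, hac, ha⟩ fun x _ hx y hy hxy => hCcl x hx y (h2.2.1 hy) hxy)
  · rintro ⟨c, hc, rfl⟩
    rw [hR, hR]
    exact hcomp c v hc

end ElimTree

/-! ### Rotations described by subtrees -/

section Rotation

variable {V : Type*} {G : SimpleGraph V} {T T₁ T' : ElimTree G}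

theorem IsRotation.parent_left {u v : V} (h : IsRotation T u v T₁) : T₁.parent u = some v := by
  rw [h.2 u]
  simp [rotParent]

/-- In both trees a vertex other than `u` and `v` is above both of them or above neither, so the
changed parents do not affect what lies below it. -/
theorem IsRotation.desc_eq {u v x : V} (h : IsRotation T u v T₁) (hxu : x ≠ u) (hxv : x ≠ v) :
    T₁.desc x = T.desc x := by
  classical
  have hvu : v ≠ u := parent_ne h.1
  have hu := h.parent_left
  have hv : T₁.parent v = T.parent u := by
    rw [h.2 v]
    simp [rotParent, hvu]
  have hch : ∀ y, y ≠ u → y ≠ v → T.parent y = some v →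
      T₁.parent y = some u ∨ T₁.parent y = some v := by
    intro y hyu hyv hy
    rw [h.2 y]
    simp only [rotParent, hyu, hyv, hy, if_true, if_false]
    split_ifs
    · exact Or.inl rfl
    · exact Or.inr rfl
  have hother : ∀ y, y ≠ u → y ≠ v → T.parent y ≠ some v → T₁.parent y = T.parent y := by
    intro y hyu hyv hy
    rw [h.2 y]
    simp [rotParent, hyu, hyv, hy]
  ext y
  constructor
  · intro hy
    rw [mem_desc_iff] at hy
    induction hy using Relation.ReflTransGen.head_induction_on with
    | refl => exact T.mem_desc_self x
    | @head y z hyz _ ih =>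
      have hvx : v ∈ T.desc x → u ∈ T.desc x := fun h' => parent_mem_desc h' hxv.symm h.1
      have hux : u ∈ T.desc x → v ∈ T.desc x := fun h' => mem_desc_trans (mem_desc_of_parent h.1) h'
      by_cases hyu : y = u
      · subst hyu
        rw [hu] at hyz
        cases hyz
        exact hvx ih
      by_cases hyv : y = v
      · subst hyv
        rw [hv] at hyz
        exact hux (mem_desc_trans (mem_desc_of_parent hyz) ih)
      by_cases hy : T.parent y = some v
      · rcases hch y hyu hyv hy with h' | h'
        · rw [h'] at hyz
          cases hyz
          exact mem_desc_trans (mem_desc_of_parent hy) (hux ih)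
        · rw [h'] at hyz
          cases hyz
          exact mem_desc_trans (mem_desc_of_parent hy) ih
      · rw [hother y hyu hyv hy] at hyz
        exact mem_desc_trans (mem_desc_of_parent hyz) ih
  · intro hy
    rw [mem_desc_iff] at hy
    induction hy using Relation.ReflTransGen.head_induction_on with
    | refl => exact T₁.mem_desc_self x
    | @head y z hyz _ ih =>
      have hux : u ∈ T₁.desc x → v ∈ T₁.desc x := fun h' => parent_mem_desc h' hxu.symm hu
      have hvx : v ∈ T₁.desc x → u ∈ T₁.desc x := fun h' => mem_desc_trans (mem_desc_of_parent hu) h'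
      by_cases hyu : y = u
      · subst hyu
        exact hvx (mem_desc_trans (mem_desc_of_parent (hv.trans hyz)) ih)
      by_cases hyv : y = v
      · subst hyv
        rw [h.1] at hyz
        cases hyz
        exact hux ih
      by_cases hy : T.parent y = some v
      · rw [hy] at hyz
        cases hyz
        rcases hch y hyu hyv hy with h' | h'
        · exact mem_desc_trans (mem_desc_of_parent h') (hvx ih)
        · exact mem_desc_trans (mem_desc_of_parent h') ih
      · exact mem_desc_trans (mem_desc_of_parent ((hother y hyu hyv hy).trans hyz)) ih

theorem parent_eq_of_desc_exchange {u v : V} (huv : u ≠ v) (hv : v ∈ T.desc u)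
    (hu : u ∈ T₁.desc v) (hD : ∀ x, x ≠ u → x ≠ v → T₁.desc x = T.desc x) :
    T.parent v = some u := by
  refine parent_eq_some_iff.2 ⟨huv.symm, hv, fun z hz hvz => ?_⟩
  by_cases hzu : z = u
  · exact hzu ▸ T.mem_desc_self z
  · rw [← hD z hzu hz] at hvz ⊢
    exact mem_desc_trans hu hvz

/-- Rotations are the exchanges of two comparable vertices that keep all other subtrees. -/
theorem isRotation_of_desc [Finite V] (hG : G.Connected) {u v : V} (huv : u ≠ v)
    (hv : v ∈ T.desc u) (hu : u ∈ T₁.desc v)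
    (hD : ∀ x, x ≠ u → x ≠ v → T₁.desc x = T.desc x) : IsRotation T u v T₁ := by
  classical
  have hpv : T.parent v = some u := parent_eq_of_desc_exchange huv hv hu hD
  have hpu : T₁.parent u = some v :=
    parent_eq_of_desc_exchange huv.symm hu hv fun x h h' => (hD x h' h).symm
  have hnv : v ∉ T₁.desc u := parent_notMem_desc hpu
  have hnu : u ∉ T.desc v := parent_notMem_desc hpv
  -- `v` takes the place of `u`
  have hpv₁ : T₁.parent v = T.parent u := by
    cases hw : T.parent u with
    | some w =>
      have hwu : w ≠ u := (parent_ne hw).symm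
      have hwv : w ≠ v := by
        rintro rfl
        exact hnu (mem_desc_of_parent hw)
      refine parent_eq_some_iff.2 ⟨hwv.symm, ?_, fun z hz hvz => ?_⟩
      · rw [hD w hwu hwv]
        exact mem_desc_trans hv (mem_desc_of_parent hw)
      · have hzu : z ≠ u := by
          rintro rfl
          exact hnv hvz
        rw [hD z hzu hz] at hvz ⊢
        exact parent_mem_desc (parent_mem_desc hvz hz.symm hpv) hzu.symm hw
    | none =>
      rw [parent_eq_none_iff_desc] at hw
      cases hw' : T₁.parent v with
      | none => rfl
      | some w =>
        have hvw := parent_ne hw'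
        have huw : u ≠ w := by
          rintro rfl
          exact hnv (mem_desc_of_parent hw')
        have h1 : v ∈ T.desc w := by
          rw [← hD w huw.symm hvw.symm]
          exact mem_desc_of_parent hw'
        have h2 := parent_mem_desc h1 hvw hpv
        exact absurd (mem_desc_antisymm h2 (hw ▸ Set.mem_univ w)) huw
  -- `v` has in `T₁` the parent `w` that `u` has in `T`, and `w` keeps its subtree. So `T₁(v)` is a
  -- connected subset of `T(w)` minus `w` that contains `u`, and it stays in the component `T(u)`.
  have hsub : T₁.desc v ⊆ T.desc u := by
    cases hw : T.parent u with
    | none =>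
      rw [parent_eq_none_iff_desc.1 hw]
      exact Set.subset_univ _
    | some w =>
      have hw₁ := hpv₁.trans hw
      have hDw : T₁.desc w = T.desc w := by
        refine hD w (parent_ne hw).symm ?_
        exact (parent_ne hw₁).symm
      refine ElimTree.connectedOn_desc hG T₁ v _ ⟨u, hu, T.mem_desc_self u⟩ ?_
      intro a _ ha b hb hab
      refine ElimTree.desc_closed hw ha ?_ ?_ hab
      · rw [← hDw]
        exact mem_desc_trans hb (mem_desc_of_parent hw₁)
      · rintro rfl
        exact parent_notMem_desc hw₁ hb
  -- a child of `u` or `v` lies below every vertex that is adjacent to its subtree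
  have hadj : ∀ {x z y}, x ≠ u → x ≠ v → y ∈ T.desc x → z ∉ T.desc x → G.Adj z y →
      x ∈ T₁.desc z := by
    intro x z y hxu hxv hy hz hzy
    rw [← hD x hxu hxv] at hy hz
    exact ElimTree.mem_desc_of_adj hy hz hzy
  have hup : ∀ {x z}, x ≠ z → z ≠ u → z ≠ v → x ∈ T.desc v → x ∈ T₁.desc z →
      T.parent x = some v → u ∈ T₁.desc z ∧ v ∈ T₁.desc z := by
    intro x z hxz hzu hzv hx hxz' hp
    rw [hD z hzu hzv] at hxz' ⊢
    have h1 := parent_mem_desc hxz' hxz hp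
    exact ⟨parent_mem_desc h1 hzv.symm hpv, h1⟩
  refine ⟨hpv, fun x => ?_⟩
  by_cases hxu : x = u
  · subst hxu
    simp [rotParent, hpu]
  by_cases hxv : x = v
  · subst hxv
    simp [rotParent, hpv₁, hxu]
  simp only [rotParent, hxu, hxv, if_false]
  by_cases hxp : T.parent x = some v
  · have hx := mem_desc_of_parent hxp
    have hux : u ∉ T.desc x := fun h' => hnu (mem_desc_trans h' hx)
    have hvx : v ∉ T.desc x := parent_notMem_desc hxp
    simp only [hxp, if_true]
    split_ifs with hex
    · obtain ⟨y, hy, huy⟩ := hex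
      refine parent_eq_some_iff.2 ⟨hxu, hadj hxu hxv hy hux huy, fun z hz hxz => ?_⟩
      by_cases hzu : z = u
      · exact hzu ▸ T₁.mem_desc_self z
      by_cases hzv : z = v
      · exact hzv ▸ hu
      exact (hup hz.symm hzu hzv hx hxz hxp).1
    · obtain ⟨y, hy, hvy⟩ := ElimTree.exists_adj_desc hG hxp
      refine parent_eq_some_iff.2 ⟨hxv, hadj hxu hxv hy hvx hvy, fun z hz hxz => ?_⟩
      by_cases hzu : z = u
      · subst hzu
        -- If `x` were below `u` in `T₁`, then `u` would be its parent there and so have a neighbour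
        -- in `T(x)`, which this case excludes.
        have hpx : T₁.parent x = some z := by
          refine parent_eq_some_iff.2 ⟨hxu, hxz, fun w hw hxw => ?_⟩
          by_cases hwu : w = z
          · exact hwu ▸ T₁.mem_desc_self w
          by_cases hwv : w = v
          · exact hwv ▸ hu
          exact (hup hw.symm hwu hwv hx hxw hxp).1
        obtain ⟨y, hy, hzy⟩ := ElimTree.exists_adj_desc hG hpx
        rw [hD x hxu hxv] at hy
        exact absurd ⟨y, hy, hzy⟩ hex
      by_cases hzv : z = v
      · exact hzv ▸ T₁.mem_desc_self z
      exact (hup hz.symm hzu hzv hx hxz hxp).2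
  · simp only [hxp, if_false]
    cases hw : T.parent x with
    | none =>
      rw [parent_eq_none_iff_desc] at hw ⊢
      rw [hD x hxu hxv, hw]
    | some w =>
      have hwv : w ≠ v := by
        rintro rfl
        exact hxp hw
      by_cases hwu : w = u
      · subst hwu
        obtain ⟨y, hy, hwy⟩ := ElimTree.exists_adj_desc hG hw
        refine parent_eq_some_iff.2
          ⟨hxu, hadj hxu hxv hy (parent_notMem_desc hw) hwy, fun z hz hxz => ?_⟩
        by_cases hzu : z = w
        · exact hzu ▸ T₁.mem_desc_self z
        by_cases hzv : z = v
        · exact hzv ▸ hu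
        rw [hD z hzu hzv] at hxz ⊢
        exact parent_mem_desc hxz hz.symm hw
      · have hxw : x ∈ T₁.desc w := by
          rw [hD w hwu hwv]
          exact mem_desc_of_parent hw
        refine parent_eq_some_iff.2 ⟨parent_ne hw, hxw, fun z hz hxz => ?_⟩
        by_cases hzuv : z = u ∨ z = v
        · have hxu' : x ∈ T.desc u := by
            refine hsub ?_
            rcases hzuv with rfl | rfl
            · exact mem_desc_trans hxz hu
            · exact hxz
          have hwu' : w ∈ T.desc u := parent_mem_desc hxu' hxu hw
          rcases mem_desc_chain hxw hxz with h | h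
          · exact h
          · rw [hD w hwu hwv] at h
            exfalso
            rcases hzuv with rfl | rfl
            · exact hwu (mem_desc_antisymm hwu' h)
            · exact hwu (mem_desc_antisymm hwu' (parent_mem_desc h hwv.symm hpv))
        · push Not at hzuv
          rw [hD z hzuv.1 hzuv.2] at hxz ⊢
          exact parent_mem_desc hxz hz.symm hw

theorem isRotation_iff [Finite V] (hG : G.Connected) {u v : V} :
    IsRotation T u v T₁ ↔ u ≠ v ∧ v ∈ T.desc u ∧ u ∈ T₁.desc v ∧
      ∀ x, x ≠ u → x ≠ v → T₁.desc x = T.desc x :=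
  ⟨fun h => ⟨(parent_ne h.1).symm, mem_desc_of_parent h.1, mem_desc_of_parent h.parent_left,
    fun _ => h.desc_eq⟩, fun h => isRotation_of_desc hG h.1 h.2.1 h.2.2.1 h.2.2.2⟩

theorem IsRotationSeq.desc_eq {σ : List (V × V)} (h : IsRotationSeq T σ T') {x : V}
    (hx : ∀ e ∈ σ, x ≠ e.1 ∧ x ≠ e.2) : T'.desc x = T.desc x := by
  induction h with
  | nil => rfl
  | @cons T T₁ T' u v σ h _ ih =>
    have h1 := hx _ List.mem_cons_self
    rw [ih fun e he => hx e (List.mem_cons_of_mem _ he), h.desc_eq h1.1 h1.2]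

/-- A rotation sequence shorter than a family of disjoint subtrees leaves one of them alone. -/
theorem IsRotationSeq.exists_untouched {σ : List (V × V)} (h : IsRotationSeq T σ T') (A : Finset V)
    (hA : ∀ s ∈ A, ∀ t ∈ A, s ≠ t → Disjoint (T.desc s) (T.desc t)) (hcard : σ.length < A.card) :
    ∃ s ∈ A, ∀ e ∈ σ, e.1 ∉ T.desc s ∧ e.2 ∉ T.desc s := by
  classical
  induction h generalizing A with
  | nil =>
    obtain ⟨s, hs⟩ := Finset.card_pos.1 hcard
    exact ⟨s, hs, by simp⟩
  | @cons T T₁ T' u v σ h _ ih =>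
    have hu : ∀ {s}, u ∈ T.desc s → v ∈ T.desc s := mem_desc_trans (mem_desc_of_parent h.1)
    have hmem : ∀ {s}, s ∈ A.filter (fun s => v ∉ T.desc s) →
        s ∈ A ∧ v ∉ T.desc s ∧ T₁.desc s = T.desc s := by
      intro s hs
      obtain ⟨hs, hvs⟩ := Finset.mem_filter.1 hs
      refine ⟨hs, hvs, h.desc_eq ?_ ?_⟩
      · rintro rfl
        exact hvs (hu (T.mem_desc_self _))
      · rintro rfl
        exact hvs (T.mem_desc_self _)
    -- A subtree containing `u` also contains its child `v`. So one rotation spoils only subtrees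
    -- containing `v`, and disjointness allows at most one.
    have hone : (A.filter (fun s => v ∈ T.desc s)).card ≤ 1 := by
      refine Finset.card_le_one.2 fun s hs t ht => ?_
      rw [Finset.mem_filter] at hs ht
      by_contra hne
      exact Set.disjoint_left.1 (hA s hs.1 t ht.1 hne) hs.2 ht.2
    have hsum := Finset.card_filter_add_card_filter_not (s := A) (fun s => v ∈ T.desc s)
    obtain ⟨s, hs, hsσ⟩ := ih (A.filter (fun s => v ∉ T.desc s)) (by
      intro s hs t ht hne
      obtain ⟨hs, -, hs'⟩ := hmem hs
      obtain ⟨ht, -, ht'⟩ := hmem ht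
      rw [hs', ht']
      exact hA s hs t ht hne) (by
      simp only [List.length_cons] at hcard
      omega)
    obtain ⟨hs, hvs, hs'⟩ := hmem hs
    refine ⟨s, hs, fun e he => ?_⟩
    rcases List.mem_cons.1 he with rfl | he
    · exact ⟨fun h' => hvs (hu h'), hvs⟩
    · exact hs' ▸ hsσ e he

end Rotation

/-! ### Restoring part of a subtree and deleting rotations -/

section Deletion

variable {V : Type*} {G : SimpleGraph V}

/-- The vertices `x` of `T(q)` such that the path from `q` to `x` lies in `S`. -/
def pathsIn (T : ElimTree G) (S : Set V) (q : V) : Set V :=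
  {x | x ∈ T.desc q ∧ ∀ y, x ∈ T.desc y → y ∈ T.desc q → y ∈ S}

/-- `T₂` is obtained from `T₁` by restoring the subtree `T(q)` of `T`, except below the vertices of
`T(q)` that are separated from `q` by a vertex outside `S`. -/
def IsRestored (T : ElimTree G) (S : Set V) (q : V) (T₁ T₂ : ElimTree G) : Prop :=
  (∀ x ∈ pathsIn T S q, T₂.desc x = T.desc x) ∧
  (∀ x ∈ T.desc q, x ∉ pathsIn T S q → T₂.desc x = T₁.desc x) ∧
  ∀ x ∉ T.desc q, T₂.desc x = T₁.desc x ∪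
    {y | y ∈ T.desc q ∧ ∃ a ∈ T₁.desc x, a ∉ T.desc q ∧ ∃ b ∈ T.desc q, G.Adj a b}

variable {T T₁ T' : ElimTree G} {S : Set V} {q : V}

/-- What lies in `T(q)` outside the restored part is covered by subtrees `T(r)` with `r` outside
`S`. These are subtrees of `T₁` too, so the two trees can be glued along them. -/
theorem exists_separator {y : V} (hy : y ∈ T.desc q) (hyL : y ∉ pathsIn T S q)
    (hS : ∀ x ∉ S, T₁.desc x = T.desc x) :
    ∃ r ∉ S, r ∈ T.desc q ∧ y ∈ T.desc r ∧ T₁.desc r = T.desc r ∧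
      ∀ x ∈ pathsIn T S q, x ∉ T.desc r := by
  have : ∃ r, y ∈ T.desc r ∧ r ∈ T.desc q ∧ r ∉ S := by
    by_contra! hcon
    exact hyL ⟨hy, hcon⟩
  obtain ⟨r, hyr, hrq, hr⟩ := this
  exact ⟨r, hr, hrq, hyr, hS r hr, fun x hx hxr => hr (hx.2 r hxr hrq)⟩

theorem mem_of_desc_meets [Finite V] (hG : G.Connected) {Q : Set V} {x y : V} (hx : x ∉ Q)
    (hy : y ∈ T₁.desc x) (hyQ : y ∈ Q) :
    ∃ a ∈ T₁.desc x, a ∉ Q ∧ ∃ b ∈ Q, G.Adj a b := by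
  by_contra! hcon
  refine ElimTree.connectedOn_desc hG T₁ x Q ⟨y, hy, hyQ⟩ ?_ (T₁.mem_desc_self x) |> hx
  intro a _ haQ b hb hab
  by_contra hbQ
  exact hcon b hb hbQ a haQ hab.symm

/-- The prescribed sets form the subtrees of an elimination tree. The vertex `c` serves the chain
condition: outer vertices whose new subtrees swallow `T(q)` must be comparable, and they are because
all are above `c`. -/
theorem exists_isRestored [Finite V] (hG : G.Connected) (hS : ∀ x ∉ S, T₁.desc x = T.desc x)
    {c : V} (hc : ∀ a ∉ T.desc q, ∀ b ∈ T.desc q, G.Adj a b → c ∈ T₁.desc a) :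
    ∃ T₂, IsRestored T S q T₁ T₂ := by
  classical
  set Q := T.desc q with hQ
  set L := pathsIn T S q with hL
  have hLQ : ∀ {x}, x ∈ L → x ∈ Q := fun h => h.1
  let N : V → Set V := fun x => {y | y ∈ Q ∧ ∃ a ∈ T₁.desc x, a ∉ Q ∧ ∃ b ∈ Q, G.Adj a b}
  let D : V → Set V := fun x => if x ∈ L then T.desc x else if x ∈ Q then T₁.desc x else
    T₁.desc x ∪ N x
  have hD1 : ∀ {x}, x ∈ L → D x = T.desc x := fun h => by simp [D, h]
  have hD2 : ∀ {x}, x ∈ Q → x ∉ L → D x = T₁.desc x := fun h h' => by simp [D, h, h']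
  have hD3 : ∀ {x}, x ∉ Q → D x = T₁.desc x ∪ N x := fun h => by
    have : _ ∉ L := fun h' => h (hLQ h')
    simp [D, h, this]
  have hsep : ∀ {y}, y ∈ Q → y ∉ L → ∃ r, r ∈ Q ∧ y ∈ T.desc r ∧ T₁.desc y ⊆ T.desc r ∧
      ∀ x ∈ L, x ∉ T.desc r := by
    intro y hy hyL
    obtain ⟨r, -, hrQ, hyr, hr, hrL⟩ := exists_separator hy hyL hS
    exact ⟨r, hrQ, hyr, hr ▸ desc_subset (hr ▸ hyr), hrL⟩
  have hDQ : ∀ {x}, x ∈ Q → D x ⊆ Q := by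
    intro x hx
    by_cases hxL : x ∈ L
    · rw [hD1 hxL]
      exact desc_subset hx
    · rw [hD2 hx hxL]
      obtain ⟨r, hrQ, -, hr, -⟩ := hsep hx hxL
      exact hr.trans (desc_subset hrQ)
  -- All or nothing: the set of an outer vertex contains `Q` or is disjoint from it.
  have hQD : ∀ {x z}, x ∉ Q → z ∈ Q → z ∈ D x → Q ⊆ D x := by
    intro x z hx hz hzx
    have : ∃ a ∈ T₁.desc x, a ∉ Q ∧ ∃ b ∈ Q, G.Adj a b := by
      rw [hD3 hx] at hzx
      rcases hzx with h | h
      · exact mem_of_desc_meets hG hx h hz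
      · exact h.2
    intro y hy
    rw [hD3 hx]
    exact Or.inr ⟨hy, this⟩
  have hout : ∀ {x z}, x ∉ Q → z ∉ Q → (z ∈ D x ↔ z ∈ T₁.desc x) := by
    intro x z hx hz
    rw [hD3 hx]
    exact ⟨fun h => h.resolve_right fun h' => hz h'.1, Or.inl⟩
  have hLnot : ∀ {x y}, x ∈ L → y ∈ Q → y ∉ L → x ∉ T₁.desc y := by
    intro x y hx hy hyL h
    obtain ⟨r, -, -, hr, hrL⟩ := hsep hy hyL
    exact hrL x hx (hr h)
  have hmix : ∀ {x y z}, x ∈ L → y ∈ Q → y ∉ L → z ∈ T.desc x → z ∈ T₁.desc y →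
      T₁.desc y ⊆ T.desc x := by
    intro x y z hx hy hyL hzx hzy
    obtain ⟨r, -, hyr, hr, hrL⟩ := hsep hy hyL
    rcases mem_desc_chain hzx (hr hzy) with h | h
    · exact absurd h (hrL x hx)
    · exact hr.trans (desc_subset h)
  have hmix' : ∀ {x y}, x ∈ L → y ∈ Q → y ∉ L → y ∈ T.desc x → T₁.desc y ⊆ T.desc x :=
    fun hx hy hyL h => hmix hx hy hyL h (T₁.mem_desc_self _)
  have hadjLQ : ∀ {x y}, x ∈ L → y ∈ Q → y ∉ L → G.Adj x y → y ∈ T.desc x := by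
    intro x y hx hy hyL hxy
    obtain ⟨r, -, hyr, hr, hrL⟩ := hsep hy hyL
    exact mem_desc_trans hyr (ElimTree.mem_desc_of_adj hyr (hrL x hx) hxy)
  refine Exists.imp (fun T₂ hT₂ => ⟨fun x hx => (hT₂ x).trans (hD1 hx),
    fun x hx hxL => (hT₂ x).trans (hD2 hx hxL), fun x hx => (hT₂ x).trans (hD3 hx)⟩)
    (ElimTree.exists_of_desc hG D ?_ ?_ ?_ ?_ ?_ ?_)
  · intro x
    by_cases hxL : x ∈ L
    · rw [hD1 hxL]
      exact T.mem_desc_self x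
    by_cases hxQ : x ∈ Q
    · rw [hD2 hxQ hxL]
      exact T₁.mem_desc_self x
    · exact (hout hxQ hxQ).2 (T₁.mem_desc_self x)
  · intro x y hy
    by_cases hxQ : x ∈ Q
    · have hyQ := hDQ hxQ hy
      by_cases hxL : x ∈ L
      · rw [hD1 hxL] at hy ⊢
        by_cases hyL : y ∈ L
        · rw [hD1 hyL]
          exact desc_subset hy
        · rw [hD2 hyQ hyL]
          exact hmix' hxL hyQ hyL hy
      · rw [hD2 hxQ hxL] at hy ⊢
        have hyL : y ∉ L := fun h => hLnot h hxQ hxL hy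
        rw [hD2 hyQ hyL]
        exact desc_subset hy
    · by_cases hyQ : y ∈ Q
      · exact (hDQ hyQ).trans (hQD hxQ hyQ hy)
      · rw [hout hxQ hyQ] at hy
        rw [hD3 hxQ, hD3 hyQ]
        refine Set.union_subset_union (desc_subset hy) ?_
        rintro z ⟨hz, a, ha, h⟩
        exact ⟨hz, a, mem_desc_trans ha hy, h⟩
  · intro x y hxy hyx
    by_cases hxQ : x ∈ Q
    · have hyQ := hDQ hxQ hyx
      by_cases hxL : x ∈ L <;> by_cases hyL : y ∈ L
      · rw [hD1 hyL] at hxy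
        rw [hD1 hxL] at hyx
        exact mem_desc_antisymm hxy hyx
      · rw [hD2 hyQ hyL] at hxy
        exact absurd hxy (hLnot hxL hyQ hyL)
      · rw [hD2 hxQ hxL] at hyx
        exact absurd hyx (hLnot hyL hxQ hxL)
      · rw [hD2 hyQ hyL] at hxy
        rw [hD2 hxQ hxL] at hyx
        exact mem_desc_antisymm hxy hyx
    · have hyQ : y ∉ Q := fun h => hxQ (hDQ h hxy)
      rw [hout hyQ hxQ] at hxy
      rw [hout hxQ hyQ] at hyx
      exact mem_desc_antisymm hxy hyx
  · intro x
    by_cases hxL : x ∈ L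
    · rw [hD1 hxL]
      exact ElimTree.connectedOn_desc hG T x
    by_cases hxQ : x ∈ Q
    · rw [hD2 hxQ hxL]
      exact ElimTree.connectedOn_desc hG T₁ x
    by_cases hN : ∃ a ∈ T₁.desc x, a ∉ Q ∧ ∃ b ∈ Q, G.Adj a b
    · obtain ⟨a, ha, -, b, hb, hab⟩ := id hN
      have hDx : D x = T₁.desc x ∪ Q := by
        rw [hD3 hxQ]
        congr 1
        exact Set.ext fun y => ⟨fun h => h.1, fun h => ⟨h, hN⟩⟩
      rw [hDx]
      intro Y hY hcl
      have h1 : (T₁.desc x ∩ Y).Nonempty → T₁.desc x ⊆ Y := fun h =>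
        ElimTree.connectedOn_desc hG T₁ x Y h fun a ha haY b hb => hcl a (Or.inl ha) haY b (Or.inl hb)
      have h2 : (Q ∩ Y).Nonempty → Q ⊆ Y := fun h =>
        ElimTree.connectedOn_desc hG T q Y h fun a ha haY b hb => hcl a (Or.inr ha) haY b (Or.inr hb)
      obtain ⟨z, hz | hz, hzY⟩ := hY
      · have h3 := h1 ⟨z, hz, hzY⟩
        exact Set.union_subset h3 (h2 ⟨b, hb, hcl a (Or.inl ha) (h3 ha) b (Or.inr hb) hab⟩)
      · have h3 := h2 ⟨z, hz, hzY⟩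
        exact Set.union_subset
          (h1 ⟨a, ha, hcl b (Or.inr hb) (h3 hb) a (Or.inl ha) hab.symm⟩) h3
    · have : N x = ∅ := Set.eq_empty_of_forall_notMem fun y hy => hN hy.2
      rw [hD3 hxQ, this, Set.union_empty]
      exact ElimTree.connectedOn_desc hG T₁ x
  · have hoi : ∀ {x y}, x ∉ Q → y ∈ Q → G.Adj x y → y ∈ D x := by
      intro x y hx hy hxy
      rw [hD3 hx]
      exact Or.inr ⟨hy, x, T₁.mem_desc_self x, hx, y, hy, hxy⟩
    intro x y hxy
    by_cases hxQ : x ∈ Q <;> by_cases hyQ : y ∈ Q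
    · by_cases hxL : x ∈ L <;> by_cases hyL : y ∈ L
      · rw [hD1 hxL, hD1 hyL]
        exact ElimTree.mem_desc_or_of_adj hxy
      · rw [hD1 hxL]
        exact Or.inr (hadjLQ hxL hyQ hyL hxy)
      · rw [hD1 hyL]
        exact Or.inl (hadjLQ hyL hxQ hxL hxy.symm)
      · rw [hD2 hxQ hxL, hD2 hyQ hyL]
        exact ElimTree.mem_desc_or_of_adj hxy
    · exact Or.inl (hoi hyQ hxQ hxy.symm)
    · exact Or.inr (hoi hxQ hyQ hxy)
    · rw [hout hyQ hxQ, hout hxQ hyQ]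
      exact ElimTree.mem_desc_or_of_adj hxy
  · intro x y z hzx hzy
    by_cases hxQ : x ∈ Q
    · have hzQ := hDQ hxQ hzx
      by_cases hyQ : y ∈ Q
      · by_cases hxL : x ∈ L <;> by_cases hyL : y ∈ L
        · rw [hD1 hxL] at hzx ⊢
          rw [hD1 hyL] at hzy ⊢
          exact mem_desc_chain hzx hzy
        · rw [hD1 hxL] at hzx ⊢
          rw [hD2 hyQ hyL] at hzy
          exact Or.inr (hmix hxL hyQ hyL hzx hzy (T₁.mem_desc_self y))
        · rw [hD1 hyL] at hzy ⊢
          rw [hD2 hxQ hxL] at hzx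
          exact Or.inl (hmix hyL hxQ hxL hzy hzx (T₁.mem_desc_self x))
        · rw [hD2 hxQ hxL] at hzx ⊢
          rw [hD2 hyQ hyL] at hzy ⊢
          exact mem_desc_chain hzx hzy
      · exact Or.inl (hQD hyQ hzQ hzy hxQ)
    · by_cases hyQ : y ∈ Q
      · exact Or.inr (hQD hxQ (hDQ hyQ hzy) hzx hyQ)
      · rw [hout hyQ hxQ, hout hxQ hyQ]
        by_cases hzQ : z ∈ Q
        · have hbelow : ∀ {x}, x ∉ Q → z ∈ D x → c ∈ T₁.desc x := by
            intro x hx hz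
            have := hQD hx hzQ hz
            have : ∃ a ∈ T₁.desc x, a ∉ Q ∧ ∃ b ∈ Q, G.Adj a b := by
              rw [hD3 hx] at hz
              rcases hz with h | h
              · exact mem_of_desc_meets hG hx h hzQ
              · exact h.2
            obtain ⟨a, ha, haQ, b, hb, hab⟩ := this
            exact mem_desc_trans (hc a haQ b hb hab) ha
          exact mem_desc_chain (hbelow hxQ hzx) (hbelow hyQ hzy)
        · rw [hout hxQ hzQ] at hzx
          rw [hout hyQ hzQ] at hzy
          exact mem_desc_chain hzx hzy

/-- When `T(q)` is a subtree of `T'`, an outside vertex adjacent to it is already above `q`, so the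
sets added to outer subtrees bring nothing new. This serves for both ends of a sequence. -/
theorem isRestored_self [Finite V] (hq : T'.desc q = T.desc q)
    (hL : ∀ x ∈ pathsIn T S q, T'.desc x = T.desc x) : IsRestored T S q T' T' := by
  refine ⟨hL, fun _ _ _ => rfl, fun x _ => (Set.union_eq_left.2 ?_).symm⟩
  rintro y ⟨hy, a, ha, haq, b, hb, hab⟩
  rw [← hq] at hy haq hb
  exact mem_desc_trans hy (mem_desc_trans (ElimTree.mem_desc_of_adj hb haq hab) ha)

theorem IsRestored.unique {T₂ T₃ : ElimTree G} (h : IsRestored T S q T₁ T₂)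
    (h' : IsRestored T S q T₁ T₃) : T₂ = T₃ := by
  refine ElimTree.ext_desc fun x => ?_
  by_cases hxL : x ∈ pathsIn T S q
  · rw [h.1 x hxL, h'.1 x hxL]
  by_cases hxQ : x ∈ T.desc q
  · rw [h.2.1 x hxQ hxL, h'.2.1 x hxQ hxL]
  · rw [h.2.2 x hxQ, h'.2.2 x hxQ]

/-- The restored trees can differ only at the endpoints outside the restored part. With both
endpoints outside it, the exchange criterion gives a rotation; with one endpoint inside, at most one
subtree can differ, which forces equality. -/
theorem IsRestored.rotation [Finite V] (hG : G.Connected) {T₃ T₂ T₄ : ElimTree G} {u v : V}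
    (hS : ∀ x ∉ S, T₁.desc x = T.desc x) (hv : v ∈ S) (hrot : IsRotation T₁ u v T₃)
    (h : IsRestored T S q T₁ T₂) (h' : IsRestored T S q T₃ T₄) :
    (u ∉ pathsIn T S q ∧ v ∉ pathsIn T S q → IsRotation T₂ u v T₄) ∧
    (u ∈ pathsIn T S q ∨ v ∈ pathsIn T S q → T₂ = T₄) := by
  obtain ⟨huv, hvu, huv₃, hD⟩ := (isRotation_iff hG).1 hrot
  have hLQ : ∀ {x}, x ∈ pathsIn T S q → x ∈ T.desc q := fun h => h.1
  have hvQ : v ∈ T.desc q → v ∉ pathsIn T S q → u ∈ T.desc q ∧ u ∉ pathsIn T S q := by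
    intro h1 h2
    obtain ⟨r, hrS, hrQ, hvr, hr, hrL⟩ := exists_separator h1 h2 hS
    have hur : u ∈ T.desc r := by
      rw [← hr] at hvr ⊢
      exact parent_mem_desc hvr (fun h => hrS (h ▸ hv)) hrot.1
    exact ⟨mem_desc_trans hur hrQ, fun h => hrL u h hur⟩
  have huQ : u ∈ T.desc q → u ∉ pathsIn T S q → v ∈ T.desc q ∧ v ∉ pathsIn T S q := by
    intro h1 h2
    obtain ⟨r, hrS, hrQ, hur, hr, hrL⟩ := exists_separator h1 h2 hS
    have hvr : v ∈ T.desc r := by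
      rw [← hr] at hur ⊢
      exact mem_desc_trans hvu hur
    exact ⟨mem_desc_trans hvr hrQ, fun h => hrL v h hvr⟩
  have hsame : ∀ x, x ≠ u ∨ x ∈ pathsIn T S q → x ≠ v ∨ x ∈ pathsIn T S q →
      T₄.desc x = T₂.desc x := by
    intro x hxu hxv
    by_cases hxL : x ∈ pathsIn T S q
    · rw [h.1 x hxL, h'.1 x hxL]
    have hDx := hD x (hxu.resolve_right hxL) (hxv.resolve_right hxL)
    by_cases hxQ : x ∈ T.desc q
    · rw [h.2.1 x hxQ hxL, h'.2.1 x hxQ hxL, hDx]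
    · rw [h.2.2 x hxQ, h'.2.2 x hxQ, hDx]
  refine ⟨fun ⟨huL, hvL⟩ => ?_, fun hL => ?_⟩
  · refine (isRotation_iff hG).2
      ⟨huv, ?_, ?_, fun x hxu hxv => hsame x (Or.inl hxu) (Or.inl hxv)⟩
    · by_cases huq : u ∈ T.desc q
      · rwa [h.2.1 u huq huL]
      · rw [h.2.2 u huq]
        exact Or.inl hvu
    · by_cases hvq : v ∈ T.desc q
      · rwa [h'.2.1 v hvq hvL]
      · rw [h'.2.2 v hvq]
        exact Or.inl huv₃
  · rcases hL with huL | hvL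
    · exact ElimTree.eq_of_desc_eq_of_ne hG (u := v) fun x hx =>
        (hsame x (by by_cases h : x = u; exacts [Or.inr (h ▸ huL), Or.inl h]) (Or.inl hx)).symm
    · exact ElimTree.eq_of_desc_eq_of_ne hG (u := u) fun x hx =>
        (hsame x (Or.inl hx) (by by_cases h : x = v; exacts [Or.inr (h ▸ hvL), Or.inl h])).symm

/-- Rotations that in the end do not change the top of the subtree `T(q)` can be left out, provided
that the neighbours of this subtree stay comparable. -/
theorem exists_shorter [Finite V] (hG : G.Connected) {σ : List (V × V)}
    (hσ : IsRotationSeq T σ T') (hσS : UsesOnly σ S)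
    (hc : ∀ T₁ : ElimTree G, (∀ x ∉ S, T₁.desc x = T.desc x) →
      ∃ c, ∀ a ∉ T.desc q, ∀ b ∈ T.desc q, G.Adj a b → c ∈ T₁.desc a)
    (hL : ∀ x ∈ pathsIn T S q, T'.desc x = T.desc x)
    (he : ∃ e ∈ σ, e.1 ∈ pathsIn T S q ∨ e.2 ∈ pathsIn T S q) :
    ∃ σ', IsRotationSeq T σ' T' ∧ σ'.length < σ.length := by
  have key : ∀ {T₁ T₃ : ElimTree G} {σ : List (V × V)}, IsRotationSeq T₁ σ T₃ → UsesOnly σ S →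
      (∀ x ∉ S, T₁.desc x = T.desc x) → ∀ T₂, IsRestored T S q T₁ T₂ →
      ∃ σ' T₄, IsRotationSeq T₂ σ' T₄ ∧ IsRestored T S q T₃ T₄ ∧ σ'.length ≤ σ.length ∧
        ((∃ e ∈ σ, e.1 ∈ pathsIn T S q ∨ e.2 ∈ pathsIn T S q) → σ'.length < σ.length) := by
    intro T₁ T₃ σ h
    induction h with
    | nil T₁ => exact fun _ _ T₂ h => ⟨[], T₂, .nil _, h, le_rfl, by simp⟩
    | @cons T₁ T₅ T₃ u v σ hrot _ ih =>
      intro huse hS T₂ hT₂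
      obtain ⟨hu, hv⟩ := huse _ List.mem_cons_self
      have hS₅ : ∀ x ∉ S, T₅.desc x = T.desc x := fun x hx => by
        rw [hrot.desc_eq (ne_of_mem_of_not_mem hu hx).symm (ne_of_mem_of_not_mem hv hx).symm, hS x hx]
      obtain ⟨c, hc⟩ := hc T₅ hS₅
      obtain ⟨T₆, hT₆⟩ := exists_isRestored hG hS₅ hc
      obtain ⟨h1, h2⟩ := hT₂.rotation hG hS hv hrot hT₆
      obtain ⟨σ', T₄, hσ', hT₄, hle, hlt⟩ :=
        ih (fun e he => huse e (List.mem_cons_of_mem _ he)) hS₅ T₆ hT₆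
      by_cases huv : u ∈ pathsIn T S q ∨ v ∈ pathsIn T S q
      · obtain rfl := h2 huv
        exact ⟨σ', T₄, hσ', hT₄, hle.trans (by simp), fun _ => by simpa using Nat.lt_succ_of_le hle⟩
      · refine ⟨(u, v) :: σ', T₄, .cons (h1 (not_or.1 huv)) hσ', hT₄, by simpa using hle, ?_⟩
        rintro ⟨e, he, heL⟩
        rcases List.mem_cons.1 he with rfl | he
        · exact absurd heL huv
        · simpa using hlt ⟨e, he, heL⟩
  have hq : q ∈ pathsIn T S q := by
    obtain ⟨e, -, he⟩ := he
    have : ∃ x, x ∈ pathsIn T S q := he.elim (fun h => ⟨_, h⟩) fun h => ⟨_, h⟩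
    obtain ⟨x, hx⟩ := this
    refine ⟨T.mem_desc_self q, fun y hqy hyq => ?_⟩
    rw [mem_desc_antisymm hyq hqy]
    exact hx.2 q hx.1 (T.mem_desc_self q)
  obtain ⟨σ', T₄, hσ', hT₄, -, hlt⟩ :=
    key hσ hσS (fun _ _ => rfl) T (isRestored_self rfl fun _ _ => rfl)
  -- `T'` is its own restoration, so the shortened sequence ends at `T'`.
  obtain rfl := hT₄.unique (isRestored_self (hL q hq) hL)
  exact ⟨σ', hσ', hlt he⟩

end Deletion

/-! ### Depth and distance in the tree -/

namespace RootedTree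

variable {V : Type*} {T : RootedTree V}

theorem graph_adj_iff {a b : V} :
    T.graph.Adj a b ↔ T.parent a = some b ∨ T.parent b = some a := by
  rw [graph, SimpleGraph.fromRel_adj]
  refine ⟨fun h => h.2, fun h => ⟨?_, h⟩⟩
  rcases h with h | h
  · exact parent_ne h
  · exact (parent_ne h).symm

theorem mem_of_connectedOn_graph {Z : Set V} (hZ : ConnectedOn T.graph Z) {x y z : V} (hx : x ∈ Z)
    (hz : z ∈ Z) (hxy : x ∈ T.desc y) (hyz : y ∈ T.desc z) : y ∈ Z := by
  by_contra hy
  have := hZ (T.desc y) ⟨x, hx, hxy⟩ (by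
    intro a ha hay b hb hab
    rcases graph_adj_iff.1 hab with h | h
    · exact parent_mem_desc hay (ne_of_mem_of_not_mem ha hy) h
    · exact mem_desc_trans (mem_desc_of_parent h) hay) hz
  exact hy (mem_desc_antisymm hyz this ▸ hz)

variable (T) in
/-- The number of ancestors of a vertex, including the vertex itself. -/
noncomputable def depth (x : V) : ℕ := (T.ancestors x).ncard

variable [Finite V]

theorem depth_of_parent {x p : V} (h : T.parent x = some p) : T.depth x = T.depth p + 1 := by
  have : T.ancestors x = insert x (T.ancestors p) := by
    ext y
    constructor
    · intro hy
      rcases mem_desc_cases (T := T) (x := x) (y := y) hy with rfl | ⟨p', hp', hy⟩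
      · exact Set.mem_insert _ _
      · rw [h] at hp'
        cases hp'
        exact Set.mem_insert_of_mem _ hy
    · rintro (rfl | hy)
      · exact T.mem_desc_self y
      · exact mem_desc_trans (T := T) (mem_desc_of_parent h) hy
  have hx : x ∉ T.ancestors p := parent_notMem_desc h
  rw [depth, this, Set.ncard_insert_of_notMem hx, depth]

theorem depth_mono {x y : V} (h : x ∈ T.desc y) : T.depth y ≤ T.depth x :=
  Set.ncard_le_ncard fun _ hz => mem_desc_trans (T := T) h hz

theorem depth_le_of_walk {a b : V} (p : T.graph.Walk a b) : T.depth a ≤ T.depth b + p.length := by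
  induction p with
  | nil => simp
  | cons h _ ih =>
    rw [SimpleGraph.Walk.length_cons]
    rcases graph_adj_iff.1 h with h | h
    · have := depth_of_parent h
      omega
    · have := depth_of_parent h
      omega

/-- Depth changes by one along each edge, so no walk is shorter than the climb from `x` to its
ancestor. -/
theorem dist_add_depth {x y : V} (h : x ∈ T.desc y) :
    T.graph.dist x y + T.depth y = T.depth x := by
  have hwalk : ∃ p : T.graph.Walk x y, p.length + T.depth y = T.depth x := by
    rw [mem_desc_iff] at h
    induction h using Relation.ReflTransGen.head_induction_on with
    | refl => exact ⟨.nil, by simp⟩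
    | head hac _ ih =>
      obtain ⟨p, hp⟩ := ih
      refine ⟨.cons (graph_adj_iff.2 (Or.inl hac)) p, ?_⟩
      have := depth_of_parent hac
      rw [SimpleGraph.Walk.length_cons]
      omega
  obtain ⟨p, hp⟩ := hwalk
  obtain ⟨p', hp'⟩ := (SimpleGraph.Walk.reachable p).exists_walk_length_eq_dist
  have h1 := depth_le_of_walk p'
  have h2 := SimpleGraph.dist_le p
  omega

theorem exists_nthAncestor {x y : V} (h : x ∈ T.desc y) :
    ∃ n, T.nthAncestor n x = some y ∧ T.depth y + n = T.depth x := by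
  rw [mem_desc_iff] at h
  induction h using Relation.ReflTransGen.head_induction_on with
  | refl => exact ⟨0, rfl, rfl⟩
  | head hac _ ih =>
    obtain ⟨n, hn, hd⟩ := ih
    refine ⟨n + 1, ?_, ?_⟩
    · simp [nthAncestor, hac, hn]
    · have := depth_of_parent hac
      omega

end RootedTree

/-! ### Components of the set of used vertices -/

section Components

variable {V : Type*} {G : SimpleGraph V} {T T' : ElimTree G}

theorem rootOf_spec [Finite V] {Z : Set V} (hne : Z.Nonempty) (hZ : ConnectedOn T.graph Z) :
    rootOf T Z ∈ Z ∧ Z ⊆ T.desc (rootOf T Z) := by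
  have hspec : rootOf T Z ∈ Z ∧
      ∀ x ∈ Z, T.graph.dist (rootOf T Z) T.root ≤ T.graph.dist x T.root :=
    Classical.epsilon_spec
      (Set.exists_min_image Z (fun x => T.graph.dist x T.root) (Set.toFinite Z) hne)
  refine ⟨hspec.1, hZ _ ⟨_, hspec.1, T.mem_desc_self _⟩ ?_⟩
  intro a ha har b hb hab
  rcases graph_adj_iff.1 hab with h | h
  · by_cases hne : a = rootOf T Z
    · have h1 := dist_add_depth (T.reaches_root a)
      have h2 := dist_add_depth (T.reaches_root b)
      have h3 := depth_of_parent h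
      have h4 := hspec.2 b hb
      rw [← hne] at h4
      change T.graph.dist a T.root + _ = _ at h1
      change T.graph.dist b T.root + _ = _ at h2
      omega
    · exact parent_mem_desc har hne h
  · exact mem_desc_trans (mem_desc_of_parent h) har

theorem pathsIn_subset {S : Set V} {q : V} : pathsIn T S q ⊆ S :=
  fun x hx => hx.2 x (T.mem_desc_self x) hx.1

theorem self_mem_pathsIn {S : Set V} {q : V} (hq : q ∈ S) : q ∈ pathsIn T S q :=
  ⟨T.mem_desc_self q, fun _ h h' => mem_desc_antisymm h h' ▸ hq⟩

theorem mem_of_mem_pathsIn {S : Set V} {q x : V} (hx : x ∈ pathsIn T S q) : q ∈ S :=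
  hx.2 q hx.1 (T.mem_desc_self q)

theorem child_mem_pathsIn {S : Set V} {q x c : V} (hx : x ∈ pathsIn T S q)
    (hc : T.parent c = some x) (hcS : c ∈ S) : c ∈ pathsIn T S q := by
  refine ⟨mem_desc_trans (mem_desc_of_parent hc) hx.1, fun y hcy hyq => ?_⟩
  by_cases hne : c = y
  · exact hne ▸ hcS
  · exact hx.2 y (parent_mem_desc hcy hne hc) hyq

theorem parent_mem_pathsIn {S : Set V} {q x p : V} (hx : x ∈ pathsIn T S q) (hne : x ≠ q)
    (hp : T.parent x = some p) : p ∈ pathsIn T S q :=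
  ⟨parent_mem_desc hx.1 hne hp, fun _ hy => hx.2 _ (mem_desc_trans (mem_desc_of_parent hp) hy)⟩

theorem connectedOn_pathsIn {S : Set V} {q : V} : ConnectedOn T.graph (pathsIn T S q) := by
  intro Y hY hcl
  have key : ∀ x, x ∈ pathsIn T S q → (x ∈ Y ↔ q ∈ Y) := by
    intro x hx
    have hxq := hx.1
    rw [mem_desc_iff] at hxq
    induction hxq using Relation.ReflTransGen.head_induction_on with
    | refl => rfl
    | @head a c hac _ ih =>
      by_cases hne : a = q
      · rw [hne]
      have hc := parent_mem_pathsIn hx hne hac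
      refine Iff.trans ?_ (ih hc)
      exact ⟨fun h => hcl a hx h c hc (graph_adj_iff.2 (Or.inl hac)),
        fun h => hcl c hc h a hx (graph_adj_iff.2 (Or.inr hac))⟩
  obtain ⟨x, hx, hxY⟩ := hY
  exact fun y hy => (key y hy).2 ((key x hx).1 hxY)

/-- Every vertex of `S` lies in a connected component of `T[S]`, with a topmost vertex `r`. -/
theorem exists_top {S : Set V} {x : V} (hx : x ∈ S) :
    ∃ r, x ∈ pathsIn T S r ∧ (r = T.root ∨ ∃ y ∉ S, T.parent r = some y) := by
  have key : ∀ r, x ∈ pathsIn T S r →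
      ∃ r, x ∈ pathsIn T S r ∧ (r = T.root ∨ ∃ y ∉ S, T.parent r = some y) := by
    intro r
    have hr := T.reaches_root r
    induction hr using Relation.ReflTransGen.head_induction_on with
    | refl => exact fun h => ⟨_, h, Or.inl rfl⟩
    | @head r y hry _ ih =>
      intro h
      by_cases hy : y ∈ S
      · refine ih ⟨mem_desc_trans h.1 (mem_desc_of_parent hry), fun z hxz hzy => ?_⟩
        rcases mem_desc_chain h.1 hxz with h' | h'
        · by_cases hrz : r = z
          · exact hrz ▸ mem_of_mem_pathsIn h
          · exact mem_desc_antisymm hzy (parent_mem_desc h' hrz hry) ▸ hy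
        · exact h.2 z hxz h'
      · exact ⟨r, h, Or.inr ⟨y, hy, hry⟩⟩
  exact key x (self_mem_pathsIn hx)

/-- Induction on the size of the subtree: the children agree, and each child's subtree agrees by
induction if the child is in `S`, and by `hS` otherwise. -/
theorem desc_eq_of_not_childrenBad [Finite V] {S : Set V} {q : V} (hS : ∀ x ∉ S, T'.desc x = T.desc x)
    (hq : ∀ x ∈ pathsIn T S q, ¬ ChildrenBad T T' x) : ∀ x ∈ pathsIn T S q,
    T'.desc x = T.desc x := by
  have key : ∀ n x, (T.desc x).ncard ≤ n → x ∈ pathsIn T S q → T'.desc x = T.desc x := by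
    intro n
    induction n with
    | zero =>
      intro x hx
      exact absurd (T.ncard_desc_pos x) (by omega)
    | succ n ih =>
      intro x hx hxL
      have hch : T.children x = T'.children x := not_not.1 (hq x hxL)
      have hc : ∀ c, T.parent c = some x → T'.desc c = T.desc c := by
        intro c hc
        by_cases hcS : c ∈ S
        · exact ih c (by have := ncard_desc_lt hc; omega) (child_mem_pathsIn hxL hc hcS)
        · exact hS c hcS
      ext y
      by_cases hyx : y = x
      · subst hyx
        exact iff_of_true (T'.mem_desc_self y) (T.mem_desc_self y)
      constructor
      · intro hy
        obtain ⟨c, hcx, hyc⟩ := exists_child hy hyx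
        have hcx' : T.parent c = some x := (Set.ext_iff.1 hch c).2 hcx
        exact mem_desc_trans (hc c hcx' ▸ hyc) (mem_desc_of_parent hcx')
      · intro hy
        obtain ⟨c, hcx, hyc⟩ := exists_child hy hyx
        exact mem_desc_trans ((hc c hcx).symm ▸ hyc)
          (mem_desc_of_parent ((Set.ext_iff.1 hch c).1 hcx))
  exact fun x => key _ x le_rfl

/-- The vertices used by a sequence of rotations. -/
def usedBy {V : Type*} (σ : List (V × V)) : Set V := {x | ∃ e ∈ σ, x = e.1 ∨ x = e.2}

theorem ncard_usedBy_le (σ : List (V × V)) : (usedBy σ).ncard ≤ 2 * σ.length := by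
  induction σ with
  | nil => simp [usedBy]
  | cons e σ ih =>
    have : usedBy (e :: σ) = insert e.1 (insert e.2 (usedBy σ)) := by
      ext x
      simp [usedBy, or_assoc]
    have h1 := Set.ncard_insert_le e.1 (insert e.2 (usedBy σ))
    have h2 := Set.ncard_insert_le e.2 (usedBy σ)
    rw [this, List.length_cons]
    omega

theorem usesOnly_usedBy (σ : List (V × V)) : UsesOnly σ (usedBy σ) :=
  fun e he => ⟨⟨e, he, Or.inl rfl⟩, ⟨e, he, Or.inr rfl⟩⟩

theorem IsRotationSeq.desc_eq_of_notMem {σ : List (V × V)} (h : IsRotationSeq T σ T') :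
    ∀ x ∉ usedBy σ, T'.desc x = T.desc x :=
  fun _ hx => h.desc_eq fun e he => ⟨fun h => hx ⟨e, he, Or.inl h⟩, fun h => hx ⟨e, he, Or.inr h⟩⟩

/-- In a shortest sequence, each connected component of the set of used vertices contains the root
or a children-bad vertex. -/
theorem exists_childrenBad_of_shortest [Finite V] (hG : G.Connected) {σ : List (V × V)}
    (hσ : IsRotationSeq T σ T') (hmin : ∀ σ', IsRotationSeq T σ' T' → σ.length ≤ σ'.length)
    {v : V} (hv : v ∈ usedBy σ) :
    ∃ r, v ∈ pathsIn T (usedBy σ) r ∧ ∃ b ∈ pathsIn T (usedBy σ) r,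
      ChildrenBad T T' b ∨ b = T.root := by
  obtain ⟨r, hvr, hr⟩ := exists_top (T := T) hv
  have hrS := mem_of_mem_pathsIn hvr
  refine ⟨r, hvr, ?_⟩
  rcases hr with hr | ⟨y, hy, hry⟩
  · exact ⟨r, self_mem_pathsIn hrS, Or.inr hr⟩
  by_contra! hcon
  -- The parent `y` of `r` is unused and keeps its subtree, so `T(r)` is the subtree of some child
  -- `c` of `y` in each intermediate tree. This `c` is below all outside neighbours of `T(r)`.
  obtain ⟨σ', hσ', hlt⟩ := exists_shorter (q := r) hG hσ (usesOnly_usedBy σ) (by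
      intro T₁ hT₁
      obtain ⟨c, hc, hcr⟩ := ElimTree.exists_child_desc_eq (T' := T₁) (hT₁ y hy).symm hry
      refine ⟨c, fun a ha b hb hab => ?_⟩
      rw [← hcr] at ha hb
      exact ElimTree.mem_desc_of_adj hb ha hab)
    (desc_eq_of_not_childrenBad hσ.desc_eq_of_notMem fun x hx => (hcon x hx).1) (by
      obtain ⟨e, he, her⟩ := id hrS
      refine ⟨e, he, her.imp (fun h => ?_) fun h => ?_⟩
      · exact h ▸ self_mem_pathsIn hrS
      · exact h ▸ self_mem_pathsIn hrS)
  exact absurd (hmin σ' hσ') (not_le.2 hlt)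

/-- The radius `2k` comes from here: a connected set of at most `2k` vertices has diameter below
`2k`. -/
theorem pathsIn_subset_ballsCB [Finite V] {S : Set V} {k : ℕ} (hcard : S.ncard ≤ 2 * k) {r b : V}
    (hb : b ∈ pathsIn T S r) (hb' : ChildrenBad T T' b ∨ b = T.root) :
    pathsIn T S r ⊆ ballsCB T T' k := by
  intro v hv
  have h1 := connectedOn_pathsIn.dist_lt_ncard hb hv
  have h2 := Set.ncard_le_ncard (pathsIn_subset (T := T) (S := S) (q := r))
  exact ⟨b, hb', by omega⟩

theorem child_mem_ballsCB {k : ℕ} (hk : 1 ≤ k) {z w : V} (hz : ChildrenBad T T' z)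
    (hw : T.parent w = some z) : w ∈ ballsCB T T' k := by
  have : T.graph.dist z w = 1 := SimpleGraph.dist_eq_one_iff_adj.2 (graph_adj_iff.2 (Or.inr hw))
  exact ⟨z, Or.inl hz, by omega⟩

end Components

/-! ### What equal types have in common -/

section Types

variable {V : Type*} {G : SimpleGraph V} {T T' : ElimTree G} {k : ℕ} {Z : Set V}

theorem wantParent_eq_none_iff {v : V} : wantParent T T' v = none ↔ T.parent v = T'.parent v := by
  unfold wantParent
  split_ifs with h <;> simp [h]

theorem parent_eq_of_wantParent_eq {x y : V} (h : wantParent T T' x = wantParent T T' y)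
    (hp : T.parent x = T.parent y) : T'.parent x = T'.parent y := by
  unfold wantParent at h
  split_ifs at h with h1 h2
  · rw [← h1, ← h2, hp]
  · exact Option.some.inj h

theorem wantParent_eq_of_typeAux_eq {n : ℕ} (hn : 0 < n) {x y : V}
    (h : typeAux T T' k Z n x = typeAux T T' k Z n y) :
    wantParent T T' x = wantParent T T' y ∧ trace T Z x = trace T Z y := by
  obtain ⟨m, rfl⟩ := Nat.exists_eq_succ_of_ne_zero hn.ne'
  exact ⟨congrArg (fun t => t.1) h, congrArg (fun t => t.2.1) h⟩

/-- Only the distinction between zero and positive counts matters, and truncation at `k + 1`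
preserves it. -/
theorem exists_child_of_typeAux_eq [Finite V] {n : ℕ} {x y c : V}
    (h : typeAux T T' k Z (n + 1) x = typeAux T T' k Z (n + 1) y) (hc : c ∈ T.children y ∩ Z) :
    ∃ d ∈ T.children x ∩ Z, typeAux T T' k Z n d = typeAux T T' k Z n c := by
  have h1 : min (k + 1)
        {u | u ∈ T.children x ∩ Z ∧ typeAux T T' k Z n u = typeAux T T' k Z n c}.ncard =
      min (k + 1)
        {u | u ∈ T.children y ∩ Z ∧ typeAux T T' k Z n u = typeAux T T' k Z n c}.ncard :=
    congrFun (congrArg (fun t => t.2.2) h) (typeAux T T' k Z n c)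
  have h2 : 0 < {u | u ∈ T.children y ∩ Z ∧
      typeAux T T' k Z n u = typeAux T T' k Z n c}.ncard :=
    (Set.ncard_pos).2 ⟨c, hc, rfl⟩
  obtain ⟨d, hd⟩ := (Set.ncard_pos).1 (show 0 < {u | u ∈ T.children x ∩ Z ∧
      typeAux T T' k Z n u = typeAux T T' k Z n c}.ncard by omega)
  exact ⟨d, hd.1, hd.2⟩

/-- Each child of `y` in `Z` is matched with a child of `x` of equal type, and the wanted parent
"unchanged" passes across the matching, level by level. The bound on `T(y)` ensures that the
recursion depth suffices. -/
theorem parent_eq_of_typeAux_eq [Finite V] (hZ : ConnectedOn T.graph Z) (n : ℕ) :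
    ∀ x y, (T.desc y).ncard ≤ n → y ∈ Z → typeAux T T' k Z n x = typeAux T T' k Z n y →
      (∀ w ∈ T.desc x, w ≠ x → T.parent w = T'.parent w) →
      ∀ w ∈ T.desc y, w ∈ Z → w ≠ y → T.parent w = T'.parent w := by
  induction n with
  | zero =>
    intro x y hy
    exact absurd (T.ncard_desc_pos y) (by omega)
  | succ n ih =>
    intro x y hn hy h hx w hw hwZ hwy
    obtain ⟨c, hc, hwc⟩ := exists_child hw hwy
    have hcZ := mem_of_connectedOn_graph hZ hwZ hy hwc (mem_desc_of_parent hc)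
    obtain ⟨d, ⟨hd, -⟩, hdc⟩ := exists_child_of_typeAux_eq h (c := c) ⟨hc, hcZ⟩
    have hcn : (T.desc c).ncard ≤ n := by
      have := ncard_desc_lt hc
      omega
    have hdx := mem_desc_of_parent (T := T.toRootedTree) hd
    by_cases hne : w = c
    · subst hne
      have hn0 : 0 < n := by
        have := T.ncard_desc_pos w
        omega
      rw [← wantParent_eq_none_iff, ← (wantParent_eq_of_typeAux_eq hn0 hdc).1,
        wantParent_eq_none_iff]
      exact hx d hdx (parent_ne hd)
    · refine ih d c hcn hcZ hdc (fun u hu hud => hx u (mem_desc_trans hu hdx) ?_) w hwc hwZ hne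
      rintro rfl
      exact hud (mem_desc_antisymm hu hdx)

theorem exists_adj_of_trace_eq [Finite V] (hZ : ConnectedOn T.graph Z) {p q s a b : V}
    (hq : T.parent q = some p) (hs : T.parent s = some p) (hqZ : q ∈ Z)
    (htr : trace T Z q = trace T Z s) (ha : a ∈ Z) (hpa : p ∈ T.desc a) (hb : b ∈ T.desc q)
    (hab : G.Adj a b) : ∃ w ∈ T.desc s, G.Adj w a := by
  classical
  obtain ⟨-, hroot⟩ := rootOf_spec ⟨a, ha⟩ hZ
  obtain ⟨n, hn, hdn⟩ := exists_nthAncestor hpa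
  have h1 := depth_of_parent hq
  have h2 := dist_add_depth (hroot hqZ)
  have h3 := depth_mono (hroot ha)
  -- `a` is the `n`-th ancestor of `p`, hence the `(n+1)`-st of both `q` and `s`; its trace
  -- coordinate has zero-based index `n`.
  have hlt : n < T.graph.dist q (rootOf T Z) := by omega
  have hanc : ∀ {c}, T.parent c = some p → T.nthAncestor (n + 1) c = some a := by
    intro c hc
    simp [nthAncestor, hc, hn]
  have h4 := congrArg (fun l : List Bool => l[n]?) htr
  simp only [trace, List.getElem?_ofFn, hlt, dif_pos] at h4
  split_ifs at h4 with h5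
  · have h6 := decide_eq_decide.1 (Option.some.inj h4)
    obtain ⟨u, hu, w, hw, hwu⟩ := h6.1 ⟨a, hanc hq, b, hb, hab.symm⟩
    rw [hanc hs] at hu
    cases hu
    exact ⟨w, hw, hwu⟩

theorem parent_eq_of_desc_eq {s w : V} (h : ∀ x ∈ T.desc s, T'.desc x = T.desc x)
    (hw : w ∈ T.desc s) (hne : w ≠ s) : T.parent w = T'.parent w := by
  rcases mem_desc_cases hw with h' | ⟨y, hy, hys⟩
  · exact absurd h' hne
  rw [hy, eq_comm]
  have hwy : w ∈ T'.desc y := by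
    rw [h y hys]
    exact mem_desc_of_parent hy
  refine parent_eq_some_iff.2 ⟨parent_ne hy, hwy, fun z hz hwz => ?_⟩
  rcases mem_desc_chain hwy hwz with h' | h'
  · exact h'
  · rw [h y hys] at h'
    have hzs := mem_desc_trans h' hys
    rw [h z hzs] at hwz ⊢
    exact parent_mem_desc hwz hz.symm hy

end Types

/-! ### Transfer from an untouched sibling -/

section Untouched

variable {V : Type*} {G : SimpleGraph V} {T T' : ElimTree G} {k : ℕ} {S Z : Set V}
  {p q s : V}

/-- If `a` is in `Z`, equal traces give it a neighbour in `T(s)`, a subtree that `T₁` retains.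
Otherwise `a` is above the root of `Z`, whose parent is outside `B` and so unused; then `T(root(Z))`
survives as a subtree of `T₁` below `a`. -/
theorem mem_desc_of_adj_of_trace_eq [Finite V] (hZ : IsCBComponent T T' k Z) (hS : S ⊆ ballsCB T T' k)
    (hq : T.parent q = some p) (hs : T.parent s = some p) (hqZ : q ∈ Z) (hsZ : s ∈ Z)
    (htr : trace T Z q = trace T Z s) (hsS : s ∉ S) {T₁ : ElimTree G}
    (hT₁ : ∀ x ∉ S, T₁.desc x = T.desc x) {a b : V} (ha : a ∉ T.desc q) (hb : b ∈ T.desc q)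
    (hab : G.Adj a b) : s ∈ T₁.desc a := by
  obtain ⟨hne, -, hconn, hcl⟩ := isComponentOf_iff.1 hZ
  have hqa : q ∈ T.desc a := ElimTree.mem_desc_of_adj hb ha hab
  have hpa : p ∈ T.desc a := parent_mem_desc hqa (fun h => ha (h ▸ T.mem_desc_self q)) hq
  by_cases haZ : a ∈ Z
  · obtain ⟨w, hw, hwa⟩ := exists_adj_of_trace_eq hconn hq hs hqZ htr haZ hpa hb hab
    have has : a ∉ T.desc s := fun h => parent_notMem_desc hs (mem_desc_trans hpa h)
    rw [← hT₁ s hsS] at hw has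
    exact ElimTree.mem_desc_of_adj hw has hwa.symm
  · obtain ⟨hr, hZr⟩ := rootOf_spec hne hconn
    have har : a ∉ T.desc (rootOf T Z) := fun h =>
      haZ (mem_of_connectedOn_graph hconn hqZ hr hqa h)
    have hra : rootOf T Z ∈ T.desc a := (mem_desc_chain hqa (hZr hqZ)).resolve_left har
    rcases mem_desc_cases hra with h | ⟨y, hy, -⟩
    · exact absurd (h ▸ hr) haZ
    have hyS : y ∉ S := by
      intro h
      exact parent_notMem_desc hy (hZr (hcl _ hr y (hS h) (graph_adj_iff.2 (Or.inl hy))))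
    obtain ⟨c, -, hc⟩ := ElimTree.exists_child_desc_eq (T' := T₁) (hT₁ y hyS).symm hy
    have hbr : b ∈ T.desc (rootOf T Z) := mem_desc_trans hb (hZr hqZ)
    have hsr := hZr hsZ
    rw [← hc] at har hbr hsr
    exact mem_desc_trans hsr (ElimTree.mem_desc_of_adj hbr har hab)

/-- If a sibling `s` of `q` of the same type has a subtree without used vertices, then no vertex of
`T(q)` in the same component is children-bad. -/
theorem not_childrenBad_of_vtype_eq [Finite V] (hG : G.Connected) (hk : 1 ≤ k) (hZ : IsCBComponent T T' k Z)
    (hS : S ⊆ ballsCB T T' k) (hT' : ∀ x ∉ S, T'.desc x = T.desc x)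
    (hq : T.parent q = some p) (hs : T.parent s = some p) (hsq : s ≠ q) (hqZ : q ∈ Z)
    (hsZ : s ∈ Z) (hty : vtype T T' k Z s = vtype T T' k Z q) (hsS : ∀ x ∈ T.desc s, x ∉ S)
    {x : V} (hx : x ∈ T.desc q) (hxZ : x ∈ Z) : ¬ ChildrenBad T T' x := by
  obtain ⟨hne, hZB, hconn, hcl⟩ := isComponentOf_iff.1 hZ
  have : Nonempty V := ⟨p⟩
  obtain ⟨hwant, htr⟩ := wantParent_eq_of_typeAux_eq Nat.card_pos hty
  have hsame : ∀ w ∈ T.desc q, w ∈ Z → w ≠ q → T.parent w = T'.parent w :=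
    parent_eq_of_typeAux_eq hconn _ s q (Set.ncard_le_card _) hqZ hty
      fun w hw hws => parent_eq_of_desc_eq (fun y hy => hT' y (hsS y hy)) hw hws
  have hout : ∀ {z w}, z ∈ Z → w ∉ Z → T.parent w = some z → w ∉ ballsCB T T' k :=
    fun hz hw h hwB => hw (hcl _ hz _ hwB (graph_adj_iff.2 (Or.inr h)))
  have hout' : ∀ {z w}, z ∈ Z → w ∉ Z → T.parent w = some z → T'.parent w = some z := by
    intro z w hz hw h
    by_contra hcon
    refine hout hz hw h (child_mem_ballsCB hk (fun he => hcon ?_) h)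
    exact (Set.ext_iff.1 he w).1 h
  -- `q` and `s` have the same parent in `T'`. If `T'(q)` had an edge leaving `T(q)` at some `b` in
  -- `T'(q)`, then `s` would be below `b`, and the common parent would lie in `T'(q)`.
  have hqq : T'.desc q ⊆ T.desc q := by
    have hpar := parent_eq_of_wantParent_eq hwant (hs.trans hq.symm)
    cases hp' : T'.parent q with
    | none =>
      rw [hp'] at hpar
      rw [T'.parent_eq_none_iff] at hpar hp'
      exact absurd (hpar.trans hp'.symm) hsq
    | some p' =>
      rw [hp'] at hpar
      have hp'q : p' ∉ T'.desc q := parent_notMem_desc hp'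
      refine ElimTree.connectedOn_desc hG T' q _ ⟨q, T'.mem_desc_self q, T.mem_desc_self q⟩ ?_
      intro a _ ha b hb hab
      by_contra hbq
      have hsb : s ∈ T'.desc b := mem_desc_of_adj_of_trace_eq hZ hS hq hs hqZ hsZ htr.symm
        (hsS s (T.mem_desc_self s)) hT' hbq ha hab.symm
      exact hp'q (parent_mem_desc (mem_desc_trans hsb hb) hsq hpar)
  have hup : ∀ {x}, x ∈ T.desc q → x ∈ Z → x ∈ T'.desc q := by
    intro x hx hxZ
    rw [mem_desc_iff] at hx
    induction hx using Relation.ReflTransGen.head_induction_on with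
    | refl => exact T'.mem_desc_self q
    | @head a c hac hc ih =>
      by_cases haq : a = q
      · exact haq ▸ T'.mem_desc_self q
      have hcZ := mem_of_connectedOn_graph hconn hxZ hqZ (mem_desc_of_parent hac) hc
      have := hsame a (mem_desc_trans (mem_desc_of_parent hac) hc) hxZ haq
      exact mem_desc_trans (mem_desc_of_parent (this ▸ hac)) (ih hcZ)
  -- `r` is a vertex at which the path from `q` down to `w` steps out of `Z`; being outside `B`, it
  -- is unused and keeps its subtree.
  have hexit : ∀ {w}, w ∈ T.desc q → w ∉ Z →
      ∃ r z, w ∈ T.desc r ∧ r ∈ T.desc q ∧ r ∉ Z ∧ z ∈ Z ∧ T.parent r = some z := by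
    intro w hw hwZ
    rw [mem_desc_iff] at hw
    induction hw using Relation.ReflTransGen.head_induction_on with
    | refl => exact absurd hqZ hwZ
    | @head a c hac hc ih =>
      by_cases hcZ : c ∈ Z
      · exact ⟨a, c, T.mem_desc_self a, mem_desc_trans (mem_desc_of_parent hac) hc, hwZ, hcZ, hac⟩
      · obtain ⟨r, z, hcr, h⟩ := ih hcZ
        exact ⟨r, z, mem_desc_trans (mem_desc_of_parent hac) hcr, h⟩
  refine not_not.2 (Set.ext fun w => ⟨fun hw => ?_, fun hw => ?_⟩)
  · change T.parent w = some x at hw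
    change T'.parent w = some x
    by_cases hwZ : w ∈ Z
    · rw [← hsame w (mem_desc_trans (mem_desc_of_parent hw) hx) hwZ, hw]
      rintro rfl
      exact parent_notMem_desc hw hx
    · exact hout' hxZ hwZ hw
  · change T'.parent w = some x at hw
    change T.parent w = some x
    have hxq := hup hx hxZ
    have hwq := hqq (mem_desc_trans (mem_desc_of_parent hw) hxq)
    have hwne : w ≠ q := by
      rintro rfl
      exact parent_notMem_desc hw hxq
    by_cases hwZ : w ∈ Z
    · rw [hsame w hwq hwZ hwne, hw]
    obtain ⟨r, z, hwr, hrq, hrZ, hzZ, hrz⟩ := hexit hwq hwZ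
    by_cases hwr' : w = r
    · subst hwr'
      rw [← hw, hout' hzZ hrZ hrz, hrz]
    · have hrS : r ∉ S := fun h => hout hzZ hrZ hrz (hS h)
      rw [← hT' r hrS] at hwr
      have hxr := parent_mem_desc hwr hwr' hw
      rw [hT' r hrS] at hxr
      exact absurd (mem_of_connectedOn_graph hconn hxZ hqZ hxr hrq) hrZ

end Untouched

/-! ### Used vertices survive the pruning -/

section Kept

variable {V : Type*} {G : SimpleGraph V} {T T' : ElimTree G} {k : ℕ} {Z P : Set V}

theorem kept_or_exists_not_kept [Finite V] (hZ : ConnectedOn T.graph Z) {v : V} (hv : v ∈ Z) :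
    Kept T Z P v ∨ ∃ q p, v ∈ T.desc q ∧ q ∈ Z ∧ p ∈ Z ∧ T.parent q = some p ∧
      ¬ Kept T Z P q ∧ Kept T Z P p := by
  obtain ⟨hr, hZr⟩ := rootOf_spec ⟨v, hv⟩ hZ
  have hvr := hZr hv
  rw [mem_desc_iff] at hvr
  induction hvr using Relation.ReflTransGen.head_induction_on with
  | refl => exact Or.inl .root
  | @head a c hac hc ih =>
    have hcZ := mem_of_connectedOn_graph hZ hv hr (mem_desc_of_parent hac) hc
    rcases ih hcZ with h | ⟨q, p, hcq, h⟩
    · by_cases ha : Kept T Z P a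
      · exact Or.inl ha
      · exact Or.inr ⟨a, c, T.mem_desc_self a, hv, hcZ, hac, ha, h⟩
    · exact Or.inr ⟨q, p, mem_desc_trans (mem_desc_of_parent hac) hcq, h⟩

/-- A vertex that is not pre-marked has a pre-marked sibling of the same type whose subtree is not
touched by the sequence. -/
theorem IsPreMarking.exists_untouched [Finite V] {σ : List (V × V)} (hP : IsPreMarking T T' k Z P)
    (hσ : IsRotationSeq T σ T') (hk : σ.length ≤ k) {p q : V} (hp : p ∈ Z) (hq : q ∈ Z)
    (hpq : T.parent q = some p) (hqP : q ∉ P) :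
    ∃ s ∈ Z, s ≠ q ∧ T.parent s = some p ∧ vtype T T' k Z s = vtype T T' k Z q ∧
      ∀ x ∈ T.desc s, x ∉ usedBy σ := by
  classical
  have := Fintype.ofFinite V
  set A := childrenOfType T T' k Z p (vtype T T' k Z q) with hA
  have hqA : q ∈ A := ⟨⟨hpq, hq⟩, rfl⟩
  have hlt : k + 1 < A.ncard := by
    by_contra hcon
    exact hqP (hP.all_of_le p hp _ (not_lt.1 hcon) hqA)
  have hcard := hP.card_of_lt p hp _ hlt
  rw [← hA, Set.ncard_eq_toFinset_card'] at hcard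
  obtain ⟨s, hs, hsσ⟩ := hσ.exists_untouched (A ∩ P).toFinset (by
    intro s hs t ht hne
    rw [Set.mem_toFinset] at hs ht
    exact disjoint_desc_of_siblings hs.1.1.1 ht.1.1.1 hne) (by omega)
  rw [Set.mem_toFinset] at hs
  refine ⟨s, hs.1.1.2, fun h => hqP (h ▸ hs.2), hs.1.1.1, hs.1.2, ?_⟩
  rintro x hx ⟨e, he, rfl | rfl⟩
  · exact (hsσ e he).1 hx
  · exact (hsσ e he).2 hx

theorem kept_of_shortest [Finite V] (hG : G.Connected) {σ : List (V × V)} (hσ : IsRotationSeq T σ T')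
    (hk : σ.length ≤ k) (hmin : ∀ σ', IsRotationSeq T σ' T' → σ.length ≤ σ'.length)
    (hZ : IsCBComponent T T' k Z) (hP : IsPreMarking T T' k Z P) {v : V} (hv : v ∈ usedBy σ)
    (hvZ : v ∈ Z) : Kept T Z P v := by
  obtain ⟨-, -, hconn, hcl⟩ := isComponentOf_iff.1 hZ
  have hk1 : 1 ≤ k := by
    obtain ⟨e, he, -⟩ := hv
    have := List.length_pos_of_mem he
    omega
  have hcard : (usedBy σ).ncard ≤ 2 * k := (ncard_usedBy_le σ).trans (by omega)
  have hS : usedBy σ ⊆ ballsCB T T' k := by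
    intro x hx
    obtain ⟨r, hxr, b, hb, hb'⟩ := exists_childrenBad_of_shortest hG hσ hmin hx
    exact pathsIn_subset_ballsCB hcard hb hb' hxr
  obtain ⟨r, hvr, b, hb, hb'⟩ := exists_childrenBad_of_shortest hG hσ hmin hv
  have hbZ : b ∈ Z := (connectedOn_pathsIn (T := T) Z ⟨v, hvr, hvZ⟩ fun x _ hxZ y hy hxy =>
    hcl x hxZ y (hS (pathsIn_subset hy)) hxy) hb
  refine (kept_or_exists_not_kept hconn hvZ).resolve_right ?_
  rintro ⟨q, p, hvq, hqZ, hpZ, hpq, hqK, hpK⟩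
  obtain ⟨s, hsZ, hsq, hps, hty, hsS⟩ := hP.exists_untouched hσ hk hpZ hqZ hpq
    fun hqP => hqK (.child hpK ⟨hpq, hqZ⟩ hqP)
  have hbad : ∀ x ∈ T.desc q, x ∈ Z → ¬ ChildrenBad T T' x := fun x hx hxZ =>
    not_childrenBad_of_vtype_eq hG hk1 hZ hS hσ.desc_eq_of_notMem hpq hps hsq hqZ hsZ hty hsS hx hxZ
  have : Nonempty V := ⟨p⟩
  have htr := (wantParent_eq_of_typeAux_eq Nat.card_pos hty).2.symm
  -- Otherwise the whole component of used vertices lies in `T(q)`, which contains neither the root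
  -- of `T` nor a children-bad vertex of `Z`. So the component passes through `q`, and `q` is used.
  have hqr : q ∈ T.desc r := by
    rcases mem_desc_chain hvq hvr.1 with h | h
    · exact h
    · have hbq := mem_desc_trans hb.1 h
      rcases hb' with hb' | rfl
      · exact absurd hb' (hbad b hbq hbZ)
      · rw [eq_root_of_mem_desc hbq, T.parent_root] at hpq
        cases hpq
  have hqS : q ∈ usedBy σ := hvr.2 q hvq hqr
  have hsub : pathsIn T (usedBy σ) q ⊆ Z := fun x hx =>
    (connectedOn_pathsIn (T := T) Z ⟨q, self_mem_pathsIn hqS, hqZ⟩ fun x _ hxZ y hy hxy =>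
      hcl x hxZ y (hS (pathsIn_subset hy)) hxy) hx
  -- The untouched sibling `s` is the common vertex below all outside neighbours of `T(q)`.
  obtain ⟨σ', hσ', hlt⟩ := exists_shorter (q := q) hG hσ (usesOnly_usedBy σ)
    (fun T₁ hT₁ => ⟨s, fun a ha b hb hab => mem_desc_of_adj_of_trace_eq hZ hS hpq hps hqZ hsZ htr
      (hsS s (T.mem_desc_self s)) hT₁ ha hb hab⟩)
    (desc_eq_of_not_childrenBad hσ.desc_eq_of_notMem fun x hx => hbad x hx.1 (hsub hx)) (by
      obtain ⟨e, he, heq⟩ := id hqS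
      refine ⟨e, he, heq.imp (fun h => ?_) fun h => ?_⟩
      · exact h ▸ self_mem_pathsIn hqS
      · exact h ▸ self_mem_pathsIn hqS)
  exact absurd (hmin σ' hσ') (not_le.2 hlt)

theorem exists_shortest (h : rotDist T T' ≤ k) : ∃ σ, IsRotationSeq T σ T' ∧ σ.length ≤ k ∧
    ∀ σ', IsRotationSeq T σ' T' → σ.length ≤ σ'.length := by
  classical
  have hex : ∃ σ, IsRotationSeq T σ T' ∧ σ.length ≤ k := by
    by_contra! hcon
    have : ((k + 1 : ℕ) : ℕ∞) ≤ rotDist T T' :=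
      le_iInf₂ fun σ hσ => Nat.cast_le.2 (hcon σ hσ)
    have := Nat.cast_le.1 (this.trans h)
    omega
  have hex' : ∃ n, ∃ σ, IsRotationSeq T σ T' ∧ σ.length = n := by
    obtain ⟨σ, hσ, -⟩ := hex
    exact ⟨_, σ, hσ, rfl⟩
  obtain ⟨σ, hσ, hlen⟩ := Nat.find_spec hex'
  have hmin : ∀ σ', IsRotationSeq T σ' T' → σ.length ≤ σ'.length := fun σ' hσ' =>
    hlen ▸ Nat.find_min' hex' ⟨σ', hσ', rfl⟩
  obtain ⟨σ₀, hσ₀, hk⟩ := hex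
  exact ⟨σ, hσ, (hmin σ₀ hσ₀).trans hk, hmin⟩

end Kept
end RotDist

theorem mainTheorem2 {V : Type*} [Finite V] (G : SimpleGraph V) (hG : G.Connected)
    (T T' : RotDist.ElimTree G) (k : ℕ) (P : Set V → Set V)
    (hP : ∀ Z, RotDist.IsCBComponent T T' k Z → RotDist.IsPreMarking T T' k Z (P Z))
    (hdist : RotDist.rotDist T T' ≤ k) :
    ∃ σ : List (V × V), σ.length ≤ k ∧ RotDist.IsRotationSeq T σ T' ∧
      RotDist.UsesOnly σ (RotDist.marked T T' k P) := by
  obtain ⟨σ, hσ, hk, hmin⟩ := RotDist.exists_shortest hdist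
  have hmarked : ∀ v ∈ RotDist.usedBy σ, v ∈ RotDist.marked T T' k P := by
    intro v hv
    obtain ⟨r, hvr, b, hb, hb'⟩ := RotDist.exists_childrenBad_of_shortest hG hσ hmin hv
    have hvB : v ∈ RotDist.ballsCB T T' k := RotDist.pathsIn_subset_ballsCB
      ((RotDist.ncard_usedBy_le σ).trans (by omega)) hb hb' hvr
    obtain ⟨Z, hZ, hvZ⟩ := RotDist.exists_isComponentOf hvB
    exact ⟨Z, hZ, Or.inl (RotDist.kept_of_shortest hG hσ hk hmin hZ (hP Z hZ) hv hvZ)⟩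
  exact ⟨σ, hk, hσ, fun e he => ⟨hmarked _ (RotDist.usesOnly_usedBy σ e he).1,
    hmarked _ (RotDist.usesOnly_usedBy σ e he).2⟩⟩
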